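/- Let $\alpha>-1$, let $\mathbb{H}$ be the quaternions with unit ball $\mathbb{D}$, let $i\in\mathbb{H}$ be an imaginary unit ($\operatorname{Re} i=0$, $|i|=1$), $\mathbb{C}_i=\mathbb{R}+i\mathbb{R}$ and $\mathbb{D}_i=\mathbb{D}\cap\mathbb{C}_i$, and let $m_i$ be Lebesgue measure on $\mathbb{C}_i$. Put $$dA_{\alpha,i}(z)=\tfrac{\alpha+1}{\pi}(1-|z|^2)^\alpha\,dm_i(z),\qquad d\mu_i(z)=\frac{1}{\pi(1-|z|^2)^2}\,dm_i(z)\qquad\text{on }\mathbb{D}_i .$$ The weighted slice Bergman space $\mathcal{A}=\mathcal{A}^2_{\alpha,i}(\mathbb{D})$ is the quaternionic right Hilbert space of all left slice hyperholomorphic functions $f:\mathbb{D}\to\mathbb{H}$ with $\int_{\mathbb{D}_i}|f|^2\,dA_{\alpha,i}<\infty$, with scalar product $\langle f,g\rangle=\int_{\mathbb{D}_i}\overline{f(z)}\,g(z)\,dA_{\alpha,i}(z)$. It has a reproducing kernel: $f(w)=\langle K_w,f\rangle$ for all $f\in\mathcal{A}$, $w\in\mathbb{D}$. Let $k_w=K_w/\sqrt{K_w(w)}$.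 The Berezin transform of a bounded right linear operator $T$ on $\mathcal{A}$ is $\widetilde T(z)=\langle k_z,Tk_z\rangle$, $z\in\mathbb{D}_i$. For a unitary anti-selfadjoint operator $J$ on $\mathcal{A}$ let $\mathcal{B}_J(\mathcal{A})$ be the set of bounded right linear operators that commute with $J$, and let the trace class $S_1(J)$ be the set of compact $T\in\mathcal{B}_J(\mathcal{A})$ whose singular values (the eigenvalues of $|T|=\sqrt{T^*T}$ in decreasing order, counted with multiplicity) are summable. For $T\in S_1(J)$ let $\operatorname{Tr}_{Ji}(T)=\sum_n\langle e_n,Te_n\rangle$, where $(e_n)$ is any orthonormal basis of the complex Hilbert space $\mathcal{A}_+^{Ji}=\{f\in\mathcal{A}: Jf=fi\}$ over $\mathbb{C}_i$. 1. Let $J$ be any unitary anti-selfadjoint operator on $\mathcal{A}$. A positive operator $T\in\mathcal{B}_J(\mathcal{A})$ belongs to $S_1(J)$ if and only if $\widetilde T\in L^1(\mathbb{D}_i,d\mu_i)$. 2. Let $J$ be the unitary anti-selfadjoint operator that maps $f\in\mathcal{A}$ to the unique left slice hyperholomorphic function $Jf$ on $\mathbb{D}$ with $(Jf)(z)=i\,f(z)$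 for $z\in\mathbb{D}_i$. If $T\in S_1(J)$, then $\widetilde T\in L^1(\mathbb{D}_i,d\mu_i)$ and $$\operatorname{Tr}_{Ji}(T)=(\alpha+1)\int_{\mathbb{D}_i}\widetilde T(z)\,d\mu_i(z).$$ -/

import Mathlib

open MeasureTheory Quaternion
open scoped MulOpposite

noncomputable section

namespace SliceBergman

/-! ### Quaternionic right Hilbert spaces and their bounded right linear operators

A right vector space over `ℍ` is a module over `ℍᵐᵒᵖ`; the vector `x a` is `MulOpposite.op a • x`. -/

/-- A quaternion-valued scalar product on a right `ℍ`-vector space, right linear in its second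
argument, which induces the given norm. -/
class QuaternionicInner (H : Type*) [NormedAddCommGroup H] [Module ℍᵐᵒᵖ H] where
  qinner : H → H → ℍ
  qinner_self : ∀ x, qinner x x = ((‖x‖ ^ 2 : ℝ) : ℍ)
  qinner_add_right : ∀ x y z, qinner x (y + z) = qinner x y + qinner x z
  qinner_smul_right : ∀ x y (a : ℍ), qinner x (MulOpposite.op a • y) = qinner x y * a
  star_qinner : ∀ x y, star (qinner y x) = qinner x y

open QuaternionicInner

section Operators

variable {H : Type*} [NormedAddCommGroup H] [Module ℍᵐᵒᵖ H] [QuaternionicInner H]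

/-- `A` is the adjoint of `T`: `⟨A x, y⟩ = ⟨x, T y⟩` for all `x`, `y`. -/
def IsAdjoint (A T : H →L[ℍᵐᵒᵖ] H) : Prop :=
  ∀ x y, qinner (A x) y = qinner x (T y)

/-- `T* = -T`. -/
def IsAntiSelfAdjoint (T : H →L[ℍᵐᵒᵖ] H) : Prop :=
  ∀ x y, qinner (-(T x)) y = qinner x (T y)

/-- `T* = T⁻¹`. -/
def IsUnitary (T : H →L[ℍᵐᵒᵖ] H) : Prop :=
  ∃ A : H →L[ℍᵐᵒᵖ] H, IsAdjoint A T ∧ (∀ x, A (T x) = x) ∧ ∀ x, T (A x) = x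

/-- `⟨x, T x⟩` is a nonnegative real number for every `x`. -/
def IsPositive (T : H →L[ℍᵐᵒᵖ] H) : Prop :=
  ∀ x, ∃ r : ℝ, 0 ≤ r ∧ qinner x (T x) = (r : ℍ)

/-- `[T, J] = 0`, that is, `T` belongs to `B_J(H)`. -/
def CommutesWith (J T : H →L[ℍᵐᵒᵖ] H) : Prop :=
  ∀ x, T (J x) = J (T x)

/-- `P = |T| = √(T* T)`: `P` is positive and `P² = T* T`. -/
def IsAbs (P T : H →L[ℍᵐᵒᵖ] H) : Prop :=
  IsPositive P ∧ ∃ A : H →L[ℍᵐᵒᵖ] H, IsAdjoint A T ∧ ∀ x, P (P x) = A (T x)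

/-- `s` is the sequence of singular values of `T`, i.e. of the eigenvalues of `|T|` in decreasing
order and counted with multiplicity: `|T| x = ∑ₙ eₙ sₙ ⟨eₙ, x⟩`, where the vectors `eₙ` that
belong to nonzero `sₙ` are orthonormal. (The other `eₙ` do not matter; they are left free so that
finite dimensional spaces, where `s` is eventually zero, are covered.) -/
def IsSingularValueSeq (T : H →L[ℍᵐᵒᵖ] H) (s : ℕ → ℝ) : Prop :=
  Antitone s ∧ (∀ n, 0 ≤ s n) ∧
    ∃ P : H →L[ℍᵐᵒᵖ] H, IsAbs P T ∧ ∃ e : ℕ → H,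
      (∀ m n, s m ≠ 0 → s n ≠ 0 → qinner (e m) (e n) = if m = n then 1 else 0) ∧
      ∀ x, HasSum (fun n => MulOpposite.op ((s n : ℍ) * qinner (e n) x) • e n) (P x)

/-- The trace class `S₁(J)`: compact operators that commute with `J` and whose sequence of
singular values is summable. -/
def MemTraceClass (J T : H →L[ℍᵐᵒᵖ] H) : Prop :=
  IsCompactOperator T ∧ CommutesWith J T ∧ ∃ s, IsSingularValueSeq T s ∧ Summable s

/-- The subspace `H₊^{Ji} = {x | J x = x i}`. -/
def plusSpace (J : H →L[ℍᵐᵒᵖ] H) (i : ℍ) : Set H :=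
  {x | J x = MulOpposite.op i • x}

/-- `b` is an orthonormal basis of the complex Hilbert space `H₊^{Ji}` over `ℂ_i`. -/
def IsPlusBasis (J : H →L[ℍᵐᵒᵖ] H) (i : ℍ) (b : Set H) : Prop :=
  b ⊆ plusSpace J i ∧
    (∀ e ∈ b, qinner e e = 1) ∧
    (∀ e ∈ b, ∀ e' ∈ b, e ≠ e' → qinner e e' = 0) ∧
    ∀ x ∈ plusSpace J i, HasSum (fun e : b => MulOpposite.op (qinner (e : H) x) • (e : H)) x

/-- `Tr_{Ji}(T) = t`, where `Tr_{Ji}(T)` is the trace of the complex linear operator induced by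
`T` on `H₊^{Ji}`: there are orthonormal bases of `H₊^{Ji}`, and for each of them the series
`∑ ⟨e, T e⟩` converges to `t`. -/
def HasTrace (J : H →L[ℍᵐᵒᵖ] H) (i : ℍ) (T : H →L[ℍᵐᵒᵖ] H) (t : ℍ) : Prop :=
  (∃ b : Set H, IsPlusBasis J i b) ∧
    ∀ b : Set H, IsPlusBasis J i b → HasSum (fun e : b => qinner (e : H) (T (e : H))) t

end Operators

/-! ### Slice hyperholomorphic functions -/

/-- The sphere `𝕊` of imaginary units. -/
abbrev ImagUnit : Type := {i : ℍ // i.re = 0 ∧ ‖i‖ = 1}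

/-- The identification `x₀ + √-1 x₁ ↦ x₀ + i x₁` of `ℂ` with the plane `ℂ_i`. Points, subsets,
functions and measures on `ℂ_i` are written as such on `ℂ`. -/
def slicePt (i : ImagUnit) (z : ℂ) : ℍ := (z.re : ℍ) + (i : ℍ) * (z.im : ℍ)

/-- `f` is left slice hyperholomorphic on the axially symmetric open set `U`: it is real
differentiable and `f (x₀ + i x₁) = a(x₀, x₁) + i b(x₀, x₁)` with `a` even and `b` odd in `x₁` and
`∂₀ a = ∂₁ b`, `∂₀ b = -∂₁ a`. -/
def IsLeftSliceHyperholomorphicOn (f : ℍ → ℍ) (U : Set ℍ) : Prop :=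
  DifferentiableOn ℝ f U ∧ ∃ a b : ℝ → ℝ → ℍ, ∀ (i : ImagUnit) (x y : ℝ), slicePt i ⟨x, y⟩ ∈ U →
    f (slicePt i ⟨x, y⟩) = a x y + (i : ℍ) * b x y ∧
    a x (-y) = a x y ∧ b x (-y) = -b x y ∧
    ∃ c d : ℍ, HasDerivAt (fun s => a s y) c x ∧ HasDerivAt (fun t => b x t) c y ∧
      HasDerivAt (fun s => b s y) d x ∧ HasDerivAt (fun t => a x t) (-d) y

/-- The open unit ball `𝔻` of `ℍ`. -/
def unitBall : Set ℍ := Metric.ball 0 1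

/-- The measure `dA_{α,i}(z) = (α+1)/π (1-|z|²)^α dm_i(z)` on `𝔻_i`. -/
def areaMeasure (α : ℝ) : Measure ℂ :=
  (volume.restrict (Metric.ball (0 : ℂ) 1)).withDensity
    fun z => ENNReal.ofReal ((α + 1) / Real.pi * (1 - ‖z‖ ^ 2) ^ α)

/-- The Möbius invariant measure `dμ_i(z) = 1/(π (1-|z|²)²) dm_i(z)` on `𝔻_i`. -/
def invMeasure : Measure ℂ :=
  (volume.restrict (Metric.ball (0 : ℂ) 1)).withDensity
    fun z => ENNReal.ofReal (1 / (Real.pi * (1 - ‖z‖ ^ 2) ^ 2))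

theorem slicePt_mem (i : ImagUnit) (z : ℂ) : slicePt i z ∈ unitBall ↔ ‖z‖ < 1 := by
  have h : ‖slicePt i z‖ = ‖z‖ := by
    obtain ⟨i, h0, h1⟩ := i
    have h2 : normSq i = 1 := by rw [normSq_eq_norm_mul_self, h1, one_mul]
    rw [normSq_def', h0] at h2
    rw [← sq_eq_sq₀ (norm_nonneg _) (norm_nonneg _), sq, ← normSq_eq_norm_mul_self, normSq_def',
      Complex.sq_norm, Complex.normSq_apply]
    simp [slicePt, h0]
    linear_combination (z.im ^ 2) * h2
  simp [unitBall, h]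

theorem continuous_slicePt (i : ImagUnit) : Continuous (slicePt i) := by
  unfold slicePt
  have : Continuous (fun r : ℝ => (r : ℍ)) := Quaternion.continuous_coe
  fun_prop

open Classical in
/-- The imaginary unit `i_x` with `x = x₀ + i_x x₁`, `x₁ = |x - x₀| ≥ 0`, where `i_x = i` if `x` is
real. -/
def unitOf (i : ImagUnit) (x : ℍ) : ImagUnit :=
  if h : x.im = 0 then i else
    ⟨‖x.im‖⁻¹ • x.im, by simp, by
      rw [norm_smul, norm_inv, norm_norm, inv_mul_cancel₀ (norm_ne_zero_iff.2 h)]⟩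

/-- The coordinates `(x₀, x₁)` with `x = x₀ + i_x x₁`. -/
def sliceCoord (x : ℍ) : ℂ := ⟨x.re, ‖x.im‖⟩

theorem slicePt_unitOf (i : ImagUnit) (x : ℍ) : slicePt (unitOf i x) (sliceCoord x) = x := by
  unfold unitOf slicePt sliceCoord
  split_ifs with h
  · conv_rhs => rw [← Quaternion.re_add_im x, h]
    simp [h]
  · have : ‖x.im‖ ≠ 0 := norm_ne_zero_iff.2 h
    conv_rhs => rw [← Quaternion.re_add_im x]
    rw [Quaternion.mul_coe_eq_smul, smul_smul, mul_inv_cancel₀ this, one_smul]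

/-- The left slice extension of a function `g` on a subset of `ℂ_i` that is symmetric with respect
to the real axis: `ext(g)(x) = ½ (1 - i_x i) g(x₀ + i x₁) + ½ (1 + i_x i) g(x₀ - i x₁)`. -/
def sliceExt (i : ImagUnit) (g : ℂ → ℍ) (x : ℍ) : ℍ :=
  (2⁻¹ : ℝ) • ((1 - (unitOf i x : ℍ) * (i : ℍ)) * g (sliceCoord x)) +
    (2⁻¹ : ℝ) • ((1 + (unitOf i x : ℍ) * (i : ℍ)) * g (star (sliceCoord x)))

/-! ### The weighted slice Bergman space -/

/-- The weighted slice Bergman space `A²_{α,i}(𝔻)` as a right vector space: left slice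
hyperholomorphic functions on `𝔻` (extended by zero outside of `𝔻`) whose restriction to `𝔻_i` is
square integrable with respect to `dA_{α,i}`. -/
def bergmanSubmodule (α : ℝ) (i : ImagUnit) : Submodule ℍᵐᵒᵖ (ℍ → ℍ) where
  carrier := {f | IsLeftSliceHyperholomorphicOn f unitBall ∧ (∀ x, x ∉ unitBall → f x = 0) ∧
    MemLp (fun z => f (slicePt i z)) 2 (areaMeasure α)}
  zero_mem' := by
    refine ⟨⟨differentiableOn_const 0, 0, 0, fun j x y _ => ⟨by simp, by simp, by simp, 0, 0, ?_⟩⟩,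
      fun x _ => rfl, MemLp.zero⟩
    simpa using ⟨hasDerivAt_const x (0 : ℍ), hasDerivAt_const y (0 : ℍ), hasDerivAt_const x (0 : ℍ),
      hasDerivAt_const y (0 : ℍ)⟩
  add_mem' := by
    rintro f g ⟨⟨hf, a, b, h⟩, hf0, hfm⟩ ⟨⟨hg, a', b', h'⟩, hg0, hgm⟩
    refine ⟨⟨hf.add hg, a + a', b + b', fun j x y hxy => ?_⟩, fun x hx => ?_, hfm.add hgm⟩
    · obtain ⟨h1, h2, h3, c, d, h4, h5, h6, h7⟩ := h j x y hxy
      obtain ⟨k1, k2, k3, c', d', k4, k5, k6, k7⟩ := h' j x y hxy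
      refine ⟨?_, ?_, ?_, c + c', d + d', h4.add k4, h5.add k5, h6.add k6, ?_⟩
      · simp only [Pi.add_apply, h1, k1, mul_add]; abel
      · simp only [Pi.add_apply, h2, k2]
      · simp only [Pi.add_apply, h3, k3]; abel
      · rw [neg_add]; exact h7.add k7
    · simp [hf0 x hx, hg0 x hx]
  smul_mem' := by
    rintro q f ⟨⟨hf, a, b, h⟩, hf0, hfm⟩
    refine ⟨⟨fun x hx => (hf x hx).mul_const q.unop, fun x y => a x y * q.unop,
      fun x y => b x y * q.unop, fun j x y hxy => ?_⟩, fun x hx => ?_, ?_⟩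
    · obtain ⟨h1, h2, h3, c, d, h4, h5, h6, h7⟩ := h j x y hxy
      refine ⟨?_, ?_, ?_, c * q.unop, d * q.unop, h4.mul_const _, h5.mul_const _,
        h6.mul_const _, ?_⟩
      · simp only [Pi.smul_apply, MulOpposite.smul_eq_mul_unop, h1, add_mul, mul_assoc]
      · simp only [h2]
      · simp only [h3, neg_mul]
      · rw [← neg_mul]; exact h7.mul_const _
    · simp [hf0 x hx]
    · exact hfm.mul_const q.unop

/-- The weighted slice Bergman space `A²_{α,i}(𝔻)`, for `α > -1`. -/
def Bergman {α : ℝ} (_hα : -1 < α) (i : ImagUnit) : Type := bergmanSubmodule α i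

section Bergman

variable {α : ℝ} {hα : -1 < α} {i : ImagUnit}

instance : AddCommGroup (Bergman hα i) := inferInstanceAs (AddCommGroup (bergmanSubmodule α i))

instance : Module ℍᵐᵒᵖ (Bergman hα i) := inferInstanceAs (Module ℍᵐᵒᵖ (bergmanSubmodule α i))

/-- Elements of the Bergman space are functions. -/
instance : CoeFun (Bergman hα i) fun _ => ℍ → ℍ := ⟨fun f => f.1⟩


theorem Bergman.slice (f : Bergman hα i) : IsLeftSliceHyperholomorphicOn f unitBall := f.2.1

theorem Bergman.eq_zero_of_notMem (f : Bergman hα i) {x : ℍ} (hx : x ∉ unitBall) : f x = 0 :=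
  f.2.2.1 x hx

theorem Bergman.memLp (f : Bergman hα i) :
    MemLp (fun z => f (slicePt i z)) 2 (areaMeasure α) := f.2.2.2

theorem Bergman.ext {f g : Bergman hα i} (h : ∀ x, f x = g x) : f = g :=
  Subtype.ext (funext h)

theorem Bergman.continuousOn (f : Bergman hα i) :
    ContinuousOn (fun z => f (slicePt i z)) (Metric.ball (0 : ℂ) 1) :=
  f.slice.1.continuousOn.comp (continuous_slicePt i).continuousOn fun z hz =>
    (slicePt_mem i z).2 (by simpa using hz)

/-- A function in the Bergman space is determined by its restriction to `𝔻_i`. -/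
theorem Bergman.eq_zero_of_slice (f : Bergman hα i)
    (h : ∀ z : ℂ, ‖z‖ < 1 → f (slicePt i z) = 0) : f = 0 := by
  refine Bergman.ext fun x => ?_
  change f x = 0
  by_cases hx : x ∈ unitBall
  · obtain ⟨_, a, b, hab⟩ := f.slice
    rw [← slicePt_unitOf i x] at hx ⊢
    set j := unitOf i x
    set z := sliceCoord x
    have hz := (slicePt_mem j z).1 hx
    have hz' : ‖star z‖ < 1 := by simpa using hz
    have h1 := hab i z.re z.im ((slicePt_mem i z).2 hz)
    have h2 := (hab i z.re (-z.im) ((slicePt_mem i (star z)).2 hz')).1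
    have e1 : f (slicePt i ⟨z.re, z.im⟩) = 0 := h z hz
    have e2 : f (slicePt i ⟨z.re, -z.im⟩) = 0 := h (star z) hz'
    rw [h1.2.1, h1.2.2.1, e2] at h2
    have h3 := h1.1
    rw [e1] at h3
    have ha : a z.re z.im = 0 := by
      have h4 : a z.re z.im + a z.re z.im = 0 := by
        rw [mul_neg, ← sub_eq_add_neg, eq_comm, sub_eq_zero] at h2
        nth_rewrite 2 [h2]
        exact h3.symm
      rw [← two_smul ℝ] at h4
      simpa using h4
    have hi : (i : ℍ) ≠ 0 := by
      intro hi; have := i.2.2; rw [hi] at this; simp at this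
    have hb : b z.re z.im = 0 := by
      rw [ha, zero_add] at h3
      exact (mul_eq_zero.1 h3.symm).resolve_left hi
    have := (hab j z.re z.im hx).1
    rw [ha, hb] at this
    simpa using this
  · exact f.eq_zero_of_notMem hx

/-- The embedding `f ↦ f|_{𝔻_i}` into `L²(dA_{α,i})`. -/
def Bergman.toL2 (hα : -1 < α) (i : ImagUnit) : Bergman hα i →+ Lp ℍ 2 (areaMeasure α) where
  toFun f := f.memLp.toLp
  map_zero' := rfl
  map_add' _ _ := rfl

theorem Bergman.toL2_injective (hα : -1 < α) (i : ImagUnit) :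
    Function.Injective (Bergman.toL2 hα i) := by
  refine (injective_iff_map_eq_zero _).2 fun f hf => f.eq_zero_of_slice ?_
  have h1 : (fun z => f (slicePt i z)) =ᵐ[areaMeasure α] fun _ => (0 : ℍ) :=
    f.memLp.coeFn_toLp.symm.trans ((Lp.eq_zero_iff_ae_eq_zero).1 hf)
  unfold areaMeasure at h1
  have hm : Measurable fun z : ℂ =>
      ENNReal.ofReal ((α + 1) / Real.pi * (1 - ‖z‖ ^ 2) ^ α) := by fun_prop
  have h2 : (fun z => f (slicePt i z)) =ᵐ[volume.restrict (Metric.ball (0 : ℂ) 1)]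
      fun _ => (0 : ℍ) := by
    have h3 := (ae_withDensity_iff hm).1 h1
    filter_upwards [h3, ae_restrict_mem Metric.isOpen_ball.measurableSet] with z hz hz1
    refine hz (ne_of_gt (ENNReal.ofReal_pos.2 ?_))
    have : ‖z‖ < 1 := by simpa using hz1
    have : 0 < 1 - ‖z‖ ^ 2 := by nlinarith [norm_nonneg z]
    have : 0 < α + 1 := by linarith
    positivity
  have h3 := Measure.eqOn_open_of_ae_eq h2 Metric.isOpen_ball f.continuousOn continuousOn_const
  exact fun z hz => h3 (by simpa using hz)

/-- The norm `‖f‖ = (∫_{𝔻_i} |f|² dA_{α,i})^{1/2}`. -/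
instance : NormedAddCommGroup (Bergman hα i) :=
  NormedAddCommGroup.induced _ _ (Bergman.toL2 hα i) (Bergman.toL2_injective hα i)

theorem Bergman.integrable_star_mul (f g : Bergman hα i) :
    Integrable (fun z => star (f (slicePt i z)) * g (slicePt i z)) (areaMeasure α) :=
  MemLp.integrable_mul (p := 2) (q := 2) f.memLp.star g.memLp

theorem Bergman.integral_normSq (f : Bergman hα i) :
    ∫ z, ‖f (slicePt i z)‖ ^ 2 ∂(areaMeasure α) = ‖f‖ ^ 2 := by
  have h : ‖f‖ = ‖f.memLp.toLp‖ := rfl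
  rw [h, ← real_inner_self_eq_norm_sq, L2.inner_def]
  refine integral_congr_ae ?_
  filter_upwards [f.memLp.coeFn_toLp] with z hz
  rw [hz, real_inner_self_eq_norm_sq]

/-- The scalar product `⟨f, g⟩ = ∫_{𝔻_i} conj(f) g dA_{α,i}`. -/
instance : QuaternionicInner (Bergman hα i) where
  qinner f g := ∫ z, star (f (slicePt i z)) * g (slicePt i z) ∂(areaMeasure α)
  qinner_self f := by
    have h : ∀ z, star (f (slicePt i z)) * f (slicePt i z) =
        (‖f (slicePt i z)‖ ^ 2) • (1 : ℍ) := fun z => by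
      rw [Quaternion.star_mul_self, normSq_eq_norm_mul_self, ← sq, ← Quaternion.coe_mul_eq_smul,
        mul_one]
    simp_rw [h]
    rw [integral_smul_const, Bergman.integral_normSq, ← Quaternion.coe_mul_eq_smul, mul_one]
  qinner_add_right f g h := by
    rw [← integral_add (f.integrable_star_mul g) (f.integrable_star_mul h)]
    refine integral_congr_ae (Filter.Eventually.of_forall fun z => ?_)
    exact mul_add _ _ _
  qinner_smul_right f g a := by
    have h := ((ContinuousLinearMap.mul ℝ ℍ).flip a).integral_comp_comm (f.integrable_star_mul g)
    simp only [ContinuousLinearMap.flip_apply, ContinuousLinearMap.mul_apply'] at h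
    rw [← h]
    refine integral_congr_ae (Filter.Eventually.of_forall fun z => ?_)
    exact (mul_assoc _ _ _).symm
  star_qinner f g := by
    let L : ℍ →ₗ[ℝ] ℍ :=
      { toFun := star, map_add' := star_add, map_smul' := fun r x => Quaternion.star_smul r x }
    have h := L.toContinuousLinearMap.integral_comp_comm (g.integrable_star_mul f)
    rw [show star (∫ z, star (g (slicePt i z)) * f (slicePt i z) ∂(areaMeasure α)) =
      L.toContinuousLinearMap (∫ z, star (g (slicePt i z)) * f (slicePt i z) ∂(areaMeasure α))
      from rfl, ← h]
    refine integral_congr_ae (Filter.Eventually.of_forall fun z => ?_)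
    change star (star (g (slicePt i z)) * f (slicePt i z)) = _
    rw [star_mul, star_star]

/-! ### The operator `J f = ext(i f_i)` -/

/-- The three quaternionic units `e₁, e₂, e₃`. -/
def stdUnit : Fin 3 → ℍ := ![⟨0, 1, 0, 0⟩, ⟨0, 0, 1, 0⟩, ⟨0, 0, 0, 1⟩]

theorem stdUnit_re (m : Fin 3) : (stdUnit m).re = 0 := by fin_cases m <;> rfl

theorem stdUnit_imI (m : Fin 3) : (stdUnit m).imI = if m = 0 then 1 else 0 := by
  fin_cases m <;> rfl

theorem stdUnit_imJ (m : Fin 3) : (stdUnit m).imJ = if m = 1 then 1 else 0 := by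
  fin_cases m <;> rfl

theorem stdUnit_imK (m : Fin 3) : (stdUnit m).imK = if m = 2 then 1 else 0 := by
  fin_cases m <;> rfl

/-- An auxiliary expression for `ext(i f_i)` from which its differentiability can be read off. -/
def auxJ (i : ImagUnit) (f : ℍ → ℍ) (x : ℍ) : ℍ :=
  let r : Fin 3 → ℍ := fun m => f (star (stdUnit m) * x * stdUnit m)
  let a : ℍ := (4⁻¹ : ℝ) • (f x + (r 0 + r 1 + r 2))
  i * a - ∑ m, stdUnit m * i * stdUnit m * ((2⁻¹ : ℝ) • ((f x - a) + (r m - a)))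

theorem star_stdUnit_mul (m : Fin 3) : star (stdUnit m) * stdUnit m = 1 := by
  fin_cases m <;> ext <;> simp [stdUnit_re, stdUnit_imI, stdUnit_imJ, stdUnit_imK]

theorem norm_stdUnit (m : Fin 3) : ‖stdUnit m‖ = 1 := by
  have h : ‖star (stdUnit m) * stdUnit m‖ = 1 := by rw [star_stdUnit_mul, norm_one]
  rw [norm_mul, Quaternion.norm_star] at h
  nlinarith [norm_nonneg (stdUnit m)]

/-- Rotated imaginary units. -/
def rotUnit (m : Fin 3) (j : ImagUnit) : ImagUnit :=
  ⟨star (stdUnit m) * j * stdUnit m, by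
    have := j.2.1
    fin_cases m <;> simp [stdUnit_re, stdUnit_imI, stdUnit_imJ, stdUnit_imK, this], by
    rw [norm_mul, norm_mul, Quaternion.norm_star, norm_stdUnit, j.2.2]; norm_num⟩

theorem slicePt_rotUnit (m : Fin 3) (j : ImagUnit) (z : ℂ) :
    slicePt (rotUnit m j) z = star (stdUnit m) * slicePt j z * stdUnit m := by
  simp only [slicePt, rotUnit, mul_add, add_mul]
  rw [Quaternion.mul_coe_eq_smul, Quaternion.mul_coe_eq_smul, Quaternion.mul_coe_eq_smul,
    smul_mul_assoc, star_stdUnit_mul, mul_smul_comm, smul_mul_assoc]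
  congr 1
  rw [← Quaternion.coe_mul_eq_smul, mul_one]

theorem auxJ_apply (i : ImagUnit) (f : ℍ → ℍ) (j : ImagUnit) (z : ℂ) (a b : ℍ)
    (h : ∀ j : ImagUnit, f (slicePt j z) = a + j * b) :
    auxJ i f (slicePt j z) = i * a + j * (i * b) := by
  have h0 := j.2.1
  have hi := i.2.1
  simp only [auxJ, ← slicePt_rotUnit, h, Fin.sum_univ_three]
  have e1 : (j : ℍ) + (rotUnit 0 j + rotUnit 1 j + rotUnit 2 j) = 0 := by
    ext <;> simp [rotUnit, stdUnit_re, stdUnit_imI, stdUnit_imJ, stdUnit_imK, h0]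
  have e2 : (4⁻¹ : ℝ) • (a + ↑j * b + (a + ↑(rotUnit 0 j) * b + (a + ↑(rotUnit 1 j) * b) +
      (a + ↑(rotUnit 2 j) * b))) = a := by
    have : a + ↑j * b + (a + ↑(rotUnit 0 j) * b + (a + ↑(rotUnit 1 j) * b) +
      (a + ↑(rotUnit 2 j) * b)) =
      (4 : ℝ) • a + ((j : ℍ) + (rotUnit 0 j + rotUnit 1 j + rotUnit 2 j)) * b := by
      have : (4 : ℝ) • a = a + a + a + a := by module
      rw [this]; noncomm_ring
    rw [this, e1, zero_mul, add_zero, smul_smul]; norm_num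
  rw [e2]
  simp only [add_sub_cancel_left, ← add_mul, ← smul_mul_assoc, ← mul_assoc]
  rw [sub_eq_add_neg, ← neg_mul]
  congr 2
  ext <;> simp [rotUnit, stdUnit_re, stdUnit_imI, stdUnit_imJ, stdUnit_imK, h0, hi] <;> ring

theorem sliceExt_apply (i : ImagUnit) (f : ℍ → ℍ) (x : ℍ) (a b : ℍ)
    (h : f (slicePt i (sliceCoord x)) = a + i * b)
    (h' : f (slicePt i (star (sliceCoord x))) = a + i * (-b)) :
    sliceExt i (fun z => i * f (slicePt i z)) x = i * a + unitOf i x * (i * b) := by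
  have hi : (i : ℍ) * i = -1 := by
    have h0 := i.2.1
    have h1 : normSq (i : ℍ) = 1 := by rw [normSq_eq_norm_mul_self, i.2.2, one_mul]
    rw [normSq_def', h0] at h1
    ext <;> simp [h0]
    · linear_combination -h1
    all_goals ring
  have h2 : (i : ℍ) * (a + i * b) = i * a - b := by
    rw [mul_add, ← mul_assoc, hi]; noncomm_ring
  have h3 : (i : ℍ) * (a + i * (-b)) = i * a + b := by
    rw [mul_add, ← mul_assoc, hi]; noncomm_ring
  simp only [sliceExt, h, h', h2, h3, ← smul_add]
  have : (1 - (unitOf i x : ℍ) * i) * (i * a - b) + (1 + (unitOf i x : ℍ) * i) * (i * a + b) =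
      (2 : ℝ) • (i * a + unitOf i x * (i * b)) := by
    rw [two_smul]; noncomm_ring
  rw [this, smul_smul]; norm_num

/-- The function `J f = ext(i f_i)` on `𝔻`, extended by zero. -/
def multFun (i : ImagUnit) (f : ℍ → ℍ) : ℍ → ℍ :=
  unitBall.indicator (sliceExt i fun z => i * f (slicePt i z))

theorem multFun_apply {f : ℍ → ℍ} {a b : ℝ → ℝ → ℍ} (i : ImagUnit)
    (h : ∀ (j : ImagUnit) (x y : ℝ), slicePt j ⟨x, y⟩ ∈ unitBall →
      f (slicePt j ⟨x, y⟩) = a x y + j * b x y ∧ a x (-y) = a x y ∧ b x (-y) = -b x y)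
    {x : ℍ} (hx : x ∈ unitBall) : multFun i f x = auxJ i f x := by
  rw [multFun, Set.indicator_of_mem hx]
  set z := sliceCoord x with hz
  have hz1 : ‖z‖ < 1 := by rw [← slicePt_unitOf i x] at hx; exact (slicePt_mem _ _).1 hx
  have hz2 : ‖star z‖ < 1 := by simpa using hz1
  have h1 := h i z.re z.im ((slicePt_mem i z).2 hz1)
  have h2 := (h i z.re (-z.im) ((slicePt_mem i (star z)).2 hz2)).1
  rw [h1.2.1, h1.2.2] at h2
  rw [sliceExt_apply i f x _ _ h1.1 h2]
  conv_rhs => rw [← slicePt_unitOf i x]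
  exact (auxJ_apply i f _ _ _ _ fun j => (h j z.re z.im ((slicePt_mem j z).2 hz1)).1).symm

theorem multFun_slice {f : ℍ → ℍ} (i : ImagUnit) (hf : IsLeftSliceHyperholomorphicOn f unitBall)
    {z : ℂ} (hz : ‖z‖ < 1) : multFun i f (slicePt i z) = i * f (slicePt i z) := by
  obtain ⟨_, a, b, h⟩ := hf
  have h' := fun (j : ImagUnit) (x y : ℝ) hxy => (⟨(h j x y hxy).1, (h j x y hxy).2.1,
    (h j x y hxy).2.2.1⟩ : _ ∧ a x (-y) = a x y ∧ b x (-y) = -b x y)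
  have h1 := fun j : ImagUnit => (h j z.re z.im ((slicePt_mem j z).2 hz)).1
  rw [multFun_apply i h' ((slicePt_mem i z).2 hz), auxJ_apply i f i z _ _ h1, ← mul_add]
  rw [← h1 i]

theorem multFun_isSlice {f : ℍ → ℍ} (i : ImagUnit)
    (hf : IsLeftSliceHyperholomorphicOn f unitBall) :
    IsLeftSliceHyperholomorphicOn (multFun i f) unitBall := by
  obtain ⟨hd, a, b, h⟩ := hf
  have h' := fun (j : ImagUnit) (x y : ℝ) hxy => (⟨(h j x y hxy).1, (h j x y hxy).2.1,
    (h j x y hxy).2.2.1⟩ : _ ∧ a x (-y) = a x y ∧ b x (-y) = -b x y)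
  refine ⟨DifferentiableOn.congr (f := auxJ i f) ?_ fun x hx => multFun_apply i h' hx,
    fun x y => i * a x y, fun x y => i * b x y, fun j x y hxy => ?_⟩
  · have hr : ∀ m, DifferentiableOn ℝ (fun x => f (star (stdUnit m) * x * stdUnit m))
        unitBall := fun m => by
      refine hd.comp (by fun_prop) fun x hx => ?_
      simp only [unitBall, Metric.mem_ball, dist_zero_right] at hx ⊢
      rwa [norm_mul, norm_mul, Quaternion.norm_star, norm_stdUnit, one_mul, mul_one]
    have ha := (hd.add (((hr 0).add (hr 1)).add (hr 2))).const_smul (4⁻¹ : ℝ)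
    exact (ha.const_mul (i : ℍ)).sub (DifferentiableOn.fun_sum fun m _ =>
      (((hd.sub ha).add ((hr m).sub ha)).const_smul (2⁻¹ : ℝ)).const_mul
        (stdUnit m * i * stdUnit m))
  · obtain ⟨_, h2, h3, c, d, h4, h5, h6, h7⟩ := h j x y hxy
    have hz := (slicePt_mem j ⟨x, y⟩).1 hxy
    refine ⟨?_, by simp only [h2], by simp only [h3, mul_neg], i * c, i * d, h4.const_mul _,
      h5.const_mul _, h6.const_mul _, ?_⟩
    · rw [multFun_apply i h' hxy]
      exact auxJ_apply i f j _ _ _ fun k => (h k x y ((slicePt_mem k _).2 hz)).1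
    · rw [← mul_neg]; exact h7.const_mul _

theorem Bergman.multFun_ae (f : Bergman hα i) :
    (fun z => (i : ℍ) * f (slicePt i z)) =ᵐ[areaMeasure α] fun z => multFun i f (slicePt i z) := by
  unfold areaMeasure
  refine (withDensity_absolutelyContinuous _ _).ae_le ?_
  filter_upwards [ae_restrict_mem Metric.isOpen_ball.measurableSet] with z hz
  exact (multFun_slice i f.slice (by simpa using hz)).symm

/-- The function `J f` as an element of the Bergman space. -/
def Bergman.mult (f : Bergman hα i) : Bergman hα i :=
  ⟨multFun i f, multFun_isSlice i f.slice, fun _ hx => Set.indicator_of_notMem hx _,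
    (memLp_congr_ae f.multFun_ae).1 (f.memLp.const_mul (i : ℍ))⟩

theorem Bergman.norm_mult (f : Bergman hα i) : ‖f.mult‖ = ‖f‖ := by
  rw [← sq_eq_sq₀ (norm_nonneg _) (norm_nonneg _), ← Bergman.integral_normSq,
    ← Bergman.integral_normSq]
  refine integral_congr_ae ?_
  filter_upwards [f.multFun_ae] with z hz
  change ‖multFun i f (slicePt i z)‖ ^ 2 = _
  rw [← hz, norm_mul, i.2.2, one_mul]

/-- The unitary and anti-selfadjoint operator `J f = ext(i f_i)` on `A²_{α,i}(𝔻)`. -/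
def bergmanJ (hα : -1 < α) (i : ImagUnit) : Bergman hα i →L[ℍᵐᵒᵖ] Bergman hα i :=
  LinearMap.mkContinuous
    { toFun := Bergman.mult
      map_add' := fun f g => Bergman.ext fun x => by
        change multFun i (f.1 + g.1) x = multFun i f x + multFun i g x
        by_cases hx : x ∈ unitBall
        · simp only [multFun, Set.indicator_of_mem hx, sliceExt, Pi.add_apply, mul_add, smul_add]
          abel
        · simp only [multFun, Set.indicator_of_notMem hx, add_zero]
      map_smul' := fun q f => Bergman.ext fun x => by
        change multFun i (q • f.1) x = multFun i f x * q.unop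
        by_cases hx : x ∈ unitBall
        · simp only [multFun, Set.indicator_of_mem hx, sliceExt, Pi.smul_apply,
            MulOpposite.smul_eq_mul_unop, add_mul, smul_mul_assoc, mul_assoc]
        · simp only [multFun, Set.indicator_of_notMem hx, zero_mul] }
    1 fun f => by
      rw [one_mul]; exact f.norm_mult.le

/-! ### The Berezin transform -/

open Classical in
/-- The reproducing kernel `K_w` at `w ∈ 𝔻`: the (unique) element of `A²_{α,i}(𝔻)` with
`f(w) = ⟨K_w, f⟩` for all `f`. -/
def bergmanKernel (hα : -1 < α) (i : ImagUnit) (w : ℍ) : Bergman hα i :=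
  if h : ∃ K : Bergman hα i, ∀ f : Bergman hα i, f w = qinner K f then h.choose else 0

/-- The normalized reproducing kernel `k_w = K_w / √K(w, w)`, where `K(q, w) = K_w(q)`. -/
def normalizedKernel (hα : -1 < α) (i : ImagUnit) (w : ℍ) : Bergman hα i :=
  MulOpposite.op (((√(bergmanKernel hα i w w).re)⁻¹ : ℝ) : ℍ) • bergmanKernel hα i w

/-- The Berezin transform `T̃(w) = ⟨k_w, T k_w⟩`, for `w = slicePt i z ∈ 𝔻_i`. -/
def berezin (T : Bergman hα i →L[ℍᵐᵒᵖ] Bergman hα i) (z : ℂ) : ℍ :=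
  qinner (normalizedKernel hα i (slicePt i z)) (T (normalizedKernel hα i (slicePt i z)))

end Bergman

end SliceBergman

end

/-! With the norm `∫ ‖f‖² dA` the normalized monomials `eₙ(z) = zⁿ/√cₙ` form an orthonormal basis of
the Bergman space, so `K_w = ∑ eₙ conj(eₙ(w))` and `K_w(w) = (1 - |w|²)^(-(α + 2))`. Hence
`(α + 1) T̃ dμ = ⟨K_z, T K_z⟩ dA`, and only this kernel form of `T` has to be integrated.

If the singular values of `T` are summable, then `T = ∑ uₙ ⟨vₙ, ·⟩` with `∑ ‖uₙ‖ ‖vₙ‖ < ∞`, so that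
`⟨K_z, T K_z⟩ = ∑ uₙ(z) conj(vₙ(z))`. Termwise integration shows that the kernel form is integrable
and that the real part of its integral is `∑ Re ⟨vₙ, uₙ⟩`, which is also the real part of the trace.
The trace and the kernel form take values in `ℂ_i`, and the same argument for `T J`, whose kernel
form is `⟨K_z, T K_z⟩ i`, gives the imaginary part.

Conversely, let `T` be positive with integrable kernel form, and let `P` be the projection onto the
span of finitely many `eₙ`. From `2 Re ⟨K_z, T P K_z⟩ ≤ ⟨K_z, T K_z⟩ + ⟨P K_z, T P K_z⟩` and the
trace formula for the finite rank operators `T P` and `P T P`, the partial sums of `∑ ⟨eₙ, T eₙ⟩`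
are at most the integral of the kernel form. So the sum converges. Then `T` is compact, and its
eigenvalues, found by deflation, are summable. -/

noncomputable section

namespace SliceBergman

open QuaternionicInner Filter Topology
open MulOpposite (op)

section RealOperators

theorem hasEigenvalue_norm_of_isPositive {𝕜 E : Type*} [RCLike 𝕜] [NormedAddCommGroup E]
    [InnerProductSpace 𝕜 E] [CompleteSpace E] {T : E →L[𝕜] E} (hT : T.IsPositive)
    (hc : IsCompactOperator T) (h0 : T ≠ 0) :
    Module.End.HasEigenvalue (T : Module.End 𝕜 E) ((‖T‖ : ℝ) : 𝕜) := by
  have hr := T.spectralRadius_eq_nnnorm hT.isSelfAdjoint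
  have hne : (spectrum 𝕜 T).Nonempty := by
    by_contra h
    rw [spectralRadius, Set.not_nonempty_iff_eq_empty.1 h] at hr
    exact h0 (nnnorm_eq_zero.1 (by simpa using hr.symm))
  obtain ⟨μ, hμ, hμr⟩ := spectrum.exists_nnnorm_eq_spectralRadius_of_nonempty hne
  have hnorm : ‖μ‖ = ‖T‖ := by
    rw [hr, ENNReal.coe_inj] at hμr
    exact congrArg NNReal.toReal hμr
  have hμ0 : μ ≠ 0 := norm_ne_zero_iff.1 (hnorm ▸ norm_ne_zero_iff.2 h0)
  have heig := (hc.hasEigenvalue_iff_mem_spectrum hμ0).2 hμ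
  obtain ⟨r, rfl⟩ : ∃ r : ℝ, (r : 𝕜) = μ :=
    RCLike.conj_eq_iff_real.1 (hT.isSymmetric.conj_eigenvalue_eq_self heig) |>.imp
      fun _ h => h.symm
  have hr0 : 0 ≤ r := eigenvalue_nonneg_of_nonneg heig hT.re_inner_nonneg_right
  rwa [← hnorm, RCLike.norm_ofReal, abs_of_nonneg hr0]

theorem norm_apply_sq_le_of_isPositive {E : Type*} [NormedAddCommGroup E] [InnerProductSpace ℝ E]
    {T : E →L[ℝ] E} (hT : T.IsPositive) (x : E) : ‖T x‖ ^ 2 ≤ ‖T‖ * inner ℝ x (T x) := by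
  let B : LinearMap.BilinForm ℝ E := (innerₗ E).compl₂ T.toLinearMap
  have hsymm : LinearMap.IsSymm B := ⟨fun y z => by
    simp only [B, LinearMap.compl₂_apply, innerₗ_apply_apply, RingHom.id_apply]
    exact (hT.isSymmetric y z).symm.trans (real_inner_comm _ _)⟩
  have hCS : inner ℝ (T x) (T x) ^ 2 ≤ inner ℝ (T x) (T (T x)) * inner ℝ x (T x) :=
    B.apply_sq_le_of_symm hT.re_inner_nonneg_right hsymm (T x) x
  rw [real_inner_self_eq_norm_sq] at hCS
  rcases eq_or_ne (T x) 0 with hx | hx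
  · simp [hx]
  have hbound : inner ℝ (T x) (T (T x)) ≤ ‖T‖ * ‖T x‖ ^ 2 :=
    calc inner ℝ (T x) (T (T x)) ≤ ‖T x‖ * ‖T (T x)‖ := real_inner_le_norm _ _
      _ ≤ ‖T x‖ * (‖T‖ * ‖T x‖) := by gcongr; exact T.le_opNorm _
      _ = ‖T‖ * ‖T x‖ ^ 2 := by ring
  have hpos : 0 < ‖T x‖ ^ 2 := by positivity
  have hnonneg : 0 ≤ inner ℝ x (T x) := hT.re_inner_nonneg_right x
  refine le_of_mul_le_mul_left ?_ hpos
  calc ‖T x‖ ^ 2 * ‖T x‖ ^ 2 = (‖T x‖ ^ 2) ^ 2 := (sq _).symm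
    _ ≤ ‖T‖ * ‖T x‖ ^ 2 * inner ℝ x (T x) := hCS.trans (by gcongr)
    _ = ‖T x‖ ^ 2 * (‖T‖ * inner ℝ x (T x)) := by ring

theorem hasSum_map_of_norm_eq {ι E F G : Type*} [AddCommGroup E] [SeminormedAddCommGroup F]
    [SeminormedAddCommGroup G] {f : E →+ F} {g : E →+ G} (h : ∀ x, ‖f x‖ = ‖g x‖) {u : ι → E}
    {x : E} (hf : HasSum (fun n => f (u n)) (f x)) : HasSum (fun n => g (u n)) (g x) := by
  unfold HasSum at hf ⊢
  rw [tendsto_iff_norm_sub_tendsto_zero] at hf ⊢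
  simpa only [← map_sum, ← map_sub, h] using hf

end RealOperators

section Geometry

variable {H : Type*} [NormedAddCommGroup H] [Module ℍᵐᵒᵖ H] [QuaternionicInner H] {ι : Type*}

theorem qinner_add_left (x y z : H) : qinner (x + y) z = qinner x z + qinner y z := by
  rw [← star_qinner, qinner_add_right, star_add, star_qinner, star_qinner]

theorem qinner_smul_left (x y : H) (a : ℍ) : qinner (op a • x) y = star a * qinner x y := by
  rw [← star_qinner, qinner_smul_right, star_mul, star_qinner]

theorem re_qinner_comm (x y : H) : (qinner x y).re = (qinner y x).re := by
  rw [← star_qinner, Quaternion.re_star]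

theorem norm_qinner_comm (x y : H) : ‖qinner x y‖ = ‖qinner y x‖ := by
  rw [← star_qinner, Quaternion.norm_star]

theorem re_qinner_self (x : H) : (qinner x x).re = ‖x‖ ^ 2 := by
  rw [qinner_self, Quaternion.re_coe]

theorem qinner_self_eq_one {x : H} : qinner x x = 1 ↔ ‖x‖ = 1 := by
  rw [qinner_self, ← Quaternion.coe_one, Quaternion.coe_inj,
    pow_eq_one_iff_of_nonneg (norm_nonneg x) two_ne_zero]

theorem norm_op_smul (a : ℍ) (x : H) : ‖op a • x‖ = ‖a‖ * ‖x‖ := by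
  have h : (qinner (op a • x) (op a • x)).re = (‖a‖ * ‖x‖) ^ 2 := by
    rw [qinner_smul_left, qinner_smul_right, qinner_self, Quaternion.coe_mul_eq_smul,
      mul_smul_comm, Quaternion.star_mul_self, normSq_eq_norm_mul_self, Quaternion.re_smul,
      Quaternion.re_coe, smul_eq_mul]
    ring
  rwa [re_qinner_self, sq_eq_sq₀ (norm_nonneg _) (by positivity)] at h

instance : NormSMulClass ℍᵐᵒᵖ H :=
  ⟨fun a x => norm_op_smul a.unop x⟩

/-- The real inner product space underlying a quaternionic right Hilbert space, with inner product
`Re ⟨x, y⟩`. It makes Mathlib's theory of real Hilbert spaces available, and is only used as a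
local instance. -/
abbrev realInnerProductSpace (H : Type*) [NormedAddCommGroup H] [Module ℍᵐᵒᵖ H]
    [QuaternionicInner H] : InnerProductSpace ℝ H where
  smul r x := op (r : ℍ) • x
  mul_smul r s x := by
    change op ((r * s : ℝ) : ℍ) • x = op (r : ℍ) • op (s : ℍ) • x
    rw [smul_smul, ← MulOpposite.op_mul, ← Quaternion.coe_mul, mul_comm]
  one_smul x := one_smul ℍᵐᵒᵖ x
  smul_zero r := smul_zero (op (r : ℍ))
  smul_add r x y := smul_add (op (r : ℍ)) x y
  add_smul r s x := by
    change op ((r + s : ℝ) : ℍ) • x = op (r : ℍ) • x + op (s : ℍ) • x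
    rw [Quaternion.coe_add, MulOpposite.op_add, add_smul]
  zero_smul x := zero_smul ℍᵐᵒᵖ x
  norm_smul_le r x := ((norm_op_smul (r : ℍ) x).trans (by rw [Quaternion.norm_coe])).le
  inner x y := (qinner x y).re
  norm_sq_eq_re_inner x := (re_qinner_self x).symm
  conj_inner_symm x y := re_qinner_comm y x
  add_left x y z := by rw [qinner_add_left, Quaternion.re_add]
  smul_left x y r := by
    change (qinner (op (r : ℍ) • x) y).re = r * (qinner x y).re
    rw [qinner_smul_left, Quaternion.star_coe, Quaternion.coe_mul_eq_smul, Quaternion.re_smul,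
      smul_eq_mul]

attribute [local instance] realInnerProductSpace

theorem real_smul_def (r : ℝ) (x : H) : r • x = op (r : ℍ) • x := rfl

theorem real_inner_def (x y : H) : inner ℝ x y = (qinner x y).re := rfl

/-- The Cauchy–Schwarz inequality for the real inner product, applied to `x` and `y ⟨y, x⟩`. -/
theorem norm_qinner_le (x y : H) : ‖qinner x y‖ ≤ ‖x‖ * ‖y‖ := by
  rcases eq_or_ne (qinner x y) 0 with h | h
  · rw [h, norm_zero]; positivity
  have hCS := real_inner_le_norm x (op (star (qinner x y)) • y)
  rw [real_inner_def, qinner_smul_right, norm_op_smul, Quaternion.norm_star,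
    Quaternion.self_mul_star, normSq_eq_norm_mul_self, Quaternion.re_coe, mul_left_comm] at hCS
  exact le_of_mul_le_mul_left hCS (norm_pos_iff.2 h)

/-- The real part of a quaternion as a continuous real linear map. -/
def reL : ℍ →L[ℝ] ℝ := innerSL ℝ (1 : ℍ)

@[simp] theorem reL_apply (q : ℍ) : reL q = q.re := by
  simp [reL, Quaternion.inner_def]

/-- `y ↦ ⟨x, y⟩` as a continuous real linear map. -/
def qinnerL (x : H) : H →L[ℝ] ℍ :=
  LinearMap.mkContinuous
    { toFun := qinner x
      map_add' := qinner_add_right x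
      map_smul' := fun r y => by
        rw [real_smul_def, qinner_smul_right, Quaternion.mul_coe_eq_smul, RingHom.id_apply] }
    ‖x‖ (norm_qinner_le x)

@[simp] theorem qinnerL_apply (x y : H) : qinnerL x y = qinner x y := rfl

@[simp] theorem qinner_zero_right (x : H) : qinner x 0 = 0 := map_zero (qinnerL x)

@[simp] theorem qinner_zero_left (x : H) : qinner 0 x = 0 := by
  rw [← star_qinner, qinner_zero_right, star_zero]

theorem qinner_neg_left (x y : H) : qinner (-x) y = -qinner x y := by
  rw [← star_qinner, ← qinnerL_apply, map_neg, star_neg, qinnerL_apply, star_qinner]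

theorem qinner_sub_right (x y z : H) : qinner x (y - z) = qinner x y - qinner x z :=
  map_sub (qinnerL x) y z

theorem qinner_sum_right (s : Finset ι) (x : H) (f : ι → H) :
    qinner x (∑ n ∈ s, f n) = ∑ n ∈ s, qinner x (f n) := map_sum (qinnerL x) f s

theorem qinner_sum_left (s : Finset ι) (x : H) (f : ι → H) :
    qinner (∑ n ∈ s, f n) x = ∑ n ∈ s, qinner (f n) x := by
  rw [← star_qinner, qinner_sum_right, star_sum]
  simp only [star_qinner]

/-- `a ↦ x a` as a continuous real linear map. -/
def rightSMulL (x : H) : ℍ →L[ℝ] H :=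
  LinearMap.mkContinuous
    { toFun := fun a => op a • x
      map_add' := fun a b => by rw [MulOpposite.op_add, add_smul]
      map_smul' := fun r a => by
        rw [RingHom.id_apply, real_smul_def, smul_smul, ← MulOpposite.op_mul,
          Quaternion.mul_coe_eq_smul] }
    ‖x‖ fun a => ((norm_op_smul a x).trans (mul_comm _ _)).le

/-- The right linear operator `x ↦ u ⟨v, x⟩`. -/
def rankOne (u v : H) : H →L[ℍᵐᵒᵖ] H where
  toFun x := op (qinner v x) • u
  map_add' x y := by rw [qinner_add_right, MulOpposite.op_add, add_smul]
  map_smul' q x := by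
    rw [← MulOpposite.op_unop q, qinner_smul_right, MulOpposite.op_mul, mul_smul,
      RingHom.id_apply]
  cont := ((rightSMulL u).comp (qinnerL v)).continuous

theorem rankOne_apply (u v x : H) : rankOne u v x = op (qinner v x) • u := rfl

theorem isCompactOperator_rankOne (u v : H) : IsCompactOperator (rankOne u v) :=
  (isCompactOperator_of_locallyCompactSpace_dom (qinnerL v)).clm_comp (rightSMulL u)

/-- The real linear operator underlying a right linear operator. -/
def toReal (T : H →L[ℍᵐᵒᵖ] H) : H →L[ℝ] H where
  toFun := T
  map_add' := map_add T
  map_smul' r x := map_smul T (op (r : ℍ)) x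
  cont := T.continuous

@[simp] theorem toReal_apply (T : H →L[ℍᵐᵒᵖ] H) (x : H) : toReal T x = T x := rfl

end Geometry

section Positive

variable {H : Type*} [NormedAddCommGroup H] [Module ℍᵐᵒᵖ H] [QuaternionicInner H]
  {P T : H →L[ℍᵐᵒᵖ] H} {s : ℕ → ℝ}

attribute [local instance] realInnerProductSpace

theorem eq_zero_of_forall_star_mul_eq {d : ℍ} (h : ∀ a, star (d * a) = d * a) : d = 0 := by
  have hd := congrArg (fun q : ℍ => q.imI) (h (star d * stdUnit 0))
  simp only [← mul_assoc, Quaternion.self_mul_star, Quaternion.coe_mul_eq_smul,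
    Quaternion.star_smul, Quaternion.imI_smul, Quaternion.imI_star, stdUnit_imI, if_true,
    smul_eq_mul] at hd
  exact Quaternion.normSq_eq_zero.1 (by linarith)

theorem IsPositive.star_qinner_apply_self (hT : IsPositive T) (x : H) :
    star (qinner x (T x)) = qinner x (T x) := by
  obtain ⟨r, -, hr⟩ := hT x
  rw [hr, Quaternion.star_coe]

/-- Polarization: with `d = ⟨x, T y⟩ - ⟨T x, y⟩`, the quaternion `d a` is selfadjoint for all
`a`. -/
theorem IsPositive.selfAdjoint (hT : IsPositive T) (x y : H) :
    qinner (T x) y = qinner x (T y) := by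
  refine (sub_eq_zero.1 (eq_zero_of_forall_star_mul_eq fun a => ?_)).symm
  have h := hT.star_qinner_apply_self (x + op a • y)
  simp only [map_add, qinner_add_left, qinner_add_right, star_add,
    hT.star_qinner_apply_self x, hT.star_qinner_apply_self (op a • y)] at h
  simp only [map_smul, qinner_smul_left, qinner_smul_right, star_mul, star_star, star_qinner] at h
  simp only [sub_mul, star_sub, star_mul, star_qinner]
  rw [← sub_eq_zero, ← sub_eq_zero.2 h]
  abel

theorem IsPositive.re_nonneg (hT : IsPositive T) (x : H) : 0 ≤ (qinner x (T x)).re := by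
  obtain ⟨r, h0, hr⟩ := hT x
  rwa [hr]

theorem IsPositive.two_mul_re_qinner_le (hT : IsPositive T) (x y : H) :
    2 * (qinner x (T y)).re ≤ (qinner x (T x)).re + (qinner y (T y)).re := by
  have hsym : (qinner y (T x)).re = (qinner x (T y)).re := by
    rw [← hT.selfAdjoint, re_qinner_comm]
  have h := hT.re_nonneg (x - y)
  rw [map_sub, ← real_inner_def, inner_sub_left, inner_sub_right, inner_sub_right] at h
  simp only [real_inner_def] at h
  linarith

theorem IsPositive.isPositive_toReal (hT : IsPositive T) : (toReal T).IsPositive :=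
  ⟨fun x y => congrArg (fun q : ℍ => q.re) (hT.selfAdjoint x y),
    fun x => (hT.re_nonneg x).trans_eq (re_qinner_comm _ _)⟩

theorem IsPositive.isAbs (hT : IsPositive T) : IsAbs T T :=
  ⟨hT, T, hT.selfAdjoint, fun _ => rfl⟩

theorem IsAbs.norm_eq (h : IsAbs P T) (x : H) : ‖P x‖ = ‖T x‖ := by
  obtain ⟨hP, A, hA, hPA⟩ := h
  rw [← sq_eq_sq₀ (norm_nonneg _) (norm_nonneg _), ← re_qinner_self, ← re_qinner_self,
    hP.selfAdjoint, hPA, re_qinner_comm, hA]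

theorem IsSingularValueSeq.exists_eigenvectors (h : IsSingularValueSeq T s) :
    ∃ P : H →L[ℍᵐᵒᵖ] H, IsAbs P T ∧ ∃ e : ℕ → H, (∀ n, ‖e n‖ ≤ 1) ∧
      (∀ n, P (e n) = op (s n : ℍ) • e n) ∧
      ∀ x, HasSum (fun n => op ((s n : ℍ) * qinner (e n) x) • e n) (P x) := by
  obtain ⟨-, -, P, hP, e, he, hsum⟩ := h
  have heig : ∀ n, s n ≠ 0 → P (e n) = op (s n : ℍ) • e n := fun n hn => by
    have hself : op (s n : ℍ) • e n = op ((s n : ℍ) * qinner (e n) (e n)) • e n := by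
      rw [he n n hn hn, if_pos rfl, mul_one]
    rw [hself]
    refine (hsum (e n)).unique (hasSum_single n fun m hm => ?_)
    rcases eq_or_ne (s m) 0 with hm0 | hm0
    · simp [hm0]
    · simp [he m n hm0 hn, hm]
  refine ⟨P, hP, fun n => if s n = 0 then 0 else e n, fun n => ?_, fun n => ?_, fun x => ?_⟩ <;>
    dsimp only
  · split_ifs with hn
    · simp
    · exact (qinner_self_eq_one.1 (by simp [he n n hn hn])).le
  · split_ifs with hn
    · simp
    · exact heig n hn
  · convert hsum x using 2 with n
    split_ifs with hn <;> simp [hn]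

end Positive

section Orthonormal

variable {H : Type*} [NormedAddCommGroup H] [Module ℍᵐᵒᵖ H] [QuaternionicInner H] {ι κ : Type*}
  {T : H →L[ℍᵐᵒᵖ] H} {b : ι → H} {u v : κ → H}

attribute [local instance] realInnerProductSpace

/-- An orthonormal family of a quaternionic right Hilbert space. -/
structure QOrthonormal (b : ι → H) : Prop where
  self : ∀ k, qinner (b k) (b k) = 1
  orthogonal : ∀ k l, k ≠ l → qinner (b k) (b l) = 0

/-- An orthonormal basis of a quaternionic right Hilbert space: every vector is the sum of its
Fourier series. -/
structure IsQBasis (b : ι → H) : Prop extends QOrthonormal b where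
  hasSum : ∀ x, HasSum (fun k => op (qinner (b k) x) • b k) x

theorem IsQBasis.hasSum_qinner (hb : IsQBasis b) (x y : H) :
    HasSum (fun k => qinner x (b k) * qinner (b k) y) (qinner x y) := by
  simpa only [qinnerL_apply, qinner_smul_right] using (hb.hasSum y).mapL (qinnerL x)

theorem IsQBasis.hasSum_norm_qinner_sq (hb : IsQBasis b) (x : H) :
    HasSum (fun k => ‖qinner (b k) x‖ ^ 2) (‖x‖ ^ 2) := by
  convert (hb.hasSum_qinner x x).mapL reL using 1
  · ext k
    rw [reL_apply, ← star_qinner x, Quaternion.star_mul_self, normSq_eq_norm_mul_self,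
      Quaternion.re_coe, sq]
  · rw [reL_apply, re_qinner_self]

theorem exists_hasSum_mul_le_of_hasSum_sq {f g : ι → ℝ} {A B : ℝ} (hA : 0 ≤ A) (hB : 0 ≤ B)
    (hf : ∀ k, 0 ≤ f k) (hg : ∀ k, 0 ≤ g k) (hfA : HasSum (fun k => f k ^ 2) (A ^ 2))
    (hgB : HasSum (fun k => g k ^ 2) (B ^ 2)) : ∃ C ≤ A * B, HasSum (fun k => f k * g k) C := by
  obtain ⟨C, -, hC, hsum⟩ := Real.inner_le_Lp_mul_Lq_hasSum_of_nonneg (p := 2) (q := 2)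
    Real.HolderConjugate.two_two hA hB hf hg (by simpa using hfA) (by simpa using hgB)
  exact ⟨C, hC, hsum⟩

theorem IsQBasis.norm_apply_le (hb : IsQBasis b) (S : H →L[ℍᵐᵒᵖ] H)
    (hS : Summable fun k => ‖S (b k)‖ ^ 2) (x : H) :
    ‖S x‖ ≤ √(∑' k, ‖S (b k)‖ ^ 2) * ‖x‖ := by
  have hx : HasSum (fun k => op (qinner (b k) x) • S (b k)) (S x) := by
    simpa only [toReal_apply, map_smul] using (hb.hasSum x).mapL (toReal S)
  have hsq : HasSum (fun k => ‖S (b k)‖ ^ 2) (√(∑' k, ‖S (b k)‖ ^ 2) ^ 2) := by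
    rw [Real.sq_sqrt (tsum_nonneg fun k => sq_nonneg _)]
    exact hS.hasSum
  obtain ⟨C, hC, hsum⟩ := exists_hasSum_mul_le_of_hasSum_sq (Real.sqrt_nonneg _) (norm_nonneg x)
    (fun k => norm_nonneg _) (fun k => norm_nonneg _) hsq (hb.hasSum_norm_qinner_sq x)
  exact (hx.norm_le_of_bounded hsum fun k => (norm_op_smul _ _).trans_le (mul_comm _ _).le).trans hC

open Classical in
theorem IsQBasis.sub_sum_rankOne_apply (hb : IsQBasis b) (T : H →L[ℍᵐᵒᵖ] H) (s : Finset ι)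
    (k : ι) :
    (T - ∑ l ∈ s, rankOne (T (b l)) (b l)) (b k) = if k ∈ s then 0 else T (b k) := by
  have hl : ∀ l, rankOne (T (b l)) (b l) (b k) = if k = l then T (b l) else 0 := fun l => by
    split_ifs with h
    · rw [rankOne_apply, h, hb.self, MulOpposite.op_one, one_smul]
    · rw [rankOne_apply, hb.orthogonal l k (Ne.symm h), MulOpposite.op_zero, zero_smul]
  simp only [sub_apply, sum_apply, hl,
    Finset.sum_ite_eq]
  split_ifs <;> simp

theorem IsQBasis.isCompactOperator_of_summable_norm_sq [CompleteSpace H] (hb : IsQBasis b)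
    (hT : Summable fun k => ‖T (b k)‖ ^ 2) : IsCompactOperator T := by
  classical
  let F : Finset ι → H →L[ℍᵐᵒᵖ] H := fun s => ∑ k ∈ s, rankOne (T (b k)) (b k)
  have hF : ∀ s, IsCompactOperator (F s) := fun s =>
    Finset.sum_induction _ (fun S : H →L[ℍᵐᵒᵖ] H => IsCompactOperator S)
      (fun _ _ => IsCompactOperator.add) isCompactOperator_zero
      fun k _ => isCompactOperator_rankOne (T (b k)) (b k)
  have htail : ∀ s, HasSum (fun k => ‖(T - F s) (b k)‖ ^ 2)
      (∑' k : { k // k ∉ s }, ‖T (b k)‖ ^ 2) := fun s => by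
    refine ((hasSum_subtype_iff_indicator (s := {k | k ∉ s})).1
      (hT.subtype _).hasSum).congr_fun fun k => ?_
    rw [hb.sub_sum_rankOne_apply T s k]
    by_cases hk : k ∈ s <;> simp [hk]
  have hnorm : ∀ s, ‖toReal (F s) - toReal T‖ ≤ √(∑' k : { k // k ∉ s }, ‖T (b k)‖ ^ 2) :=
    fun s => by
      refine ContinuousLinearMap.opNorm_le_bound _ (Real.sqrt_nonneg _) fun x => ?_
      rw [← (htail s).tsum_eq]
      refine (norm_sub_rev _ _).trans_le (hb.norm_apply_le (T - F s) (htail s).summable x)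
  have hlim : Tendsto (fun s => toReal (F s)) atTop (𝓝 (toReal T)) := by
    refine tendsto_iff_norm_sub_tendsto_zero.2 (squeeze_zero (fun s => norm_nonneg _) hnorm ?_)
    simpa using (tendsto_tsum_compl_atTop_zero fun k => ‖T (b k)‖ ^ 2).sqrt
  exact isCompactOperator_of_tendsto (F := fun s => toReal (F s)) hlim
    (Eventually.of_forall hF)

theorem IsQBasis.isCompactOperator_of_isPositive [CompleteSpace H] (hb : IsQBasis b)
    (hT : IsPositive T) (hsum : Summable fun k => (qinner (b k) (T (b k))).re) :
    IsCompactOperator T :=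
  hb.isCompactOperator_of_summable_norm_sq <| (hsum.mul_left ‖toReal T‖).of_nonneg_of_le
    (fun _ => sq_nonneg _) fun k => norm_apply_sq_le_of_isPositive hT.isPositive_toReal (b k)

end Orthonormal

section Nuclear

variable {H : Type*} [NormedAddCommGroup H] [Module ℍᵐᵒᵖ H] [QuaternionicInner H] {ι κ : Type*}
  {A S T : H →L[ℍᵐᵒᵖ] H} {b : ι → H} {u v : κ → H}

attribute [local instance] realInnerProductSpace

/-- The nuclear representation `T = ∑ₙ uₙ ⟨vₙ, ·⟩` with `∑ₙ ‖uₙ‖ ‖vₙ‖ < ∞`. -/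
structure IsNuclearRep (u v : κ → H) (T : H →L[ℍᵐᵒᵖ] H) : Prop where
  summable : Summable fun n => ‖u n‖ * ‖v n‖
  hasSum : ∀ x, HasSum (fun n => op (qinner (v n) x) • u n) (T x)

theorem IsNuclearRep.hasSum_qinner (h : IsNuclearRep u v T) (x y : H) :
    HasSum (fun n => qinner x (u n) * qinner (v n) y) (qinner x (T y)) := by
  simpa only [qinnerL_apply, qinner_smul_right] using (h.hasSum y).mapL (qinnerL x)

theorem IsNuclearRep.comp (h : IsNuclearRep u v T) (hA : IsAdjoint A S) :
    IsNuclearRep u (fun n => A (v n)) (T.comp S) where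
  summable := (h.summable.mul_left ‖toReal A‖).of_nonneg_of_le (fun n => by positivity) fun n =>
    (mul_le_mul_of_nonneg_left ((toReal A).le_opNorm (v n)) (norm_nonneg (u n))).trans_eq
      (mul_left_comm _ _ _)
  hasSum x := by
    simpa only [hA (v _) x, ContinuousLinearMap.comp_apply] using h.hasSum (S x)

theorem IsNuclearRep.comp_left (h : IsNuclearRep u v T) (S : H →L[ℍᵐᵒᵖ] H) :
    IsNuclearRep (fun n => S (u n)) v (S.comp T) where
  summable := (h.summable.mul_left ‖toReal S‖).of_nonneg_of_le (fun n => by positivity) fun n =>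
    (mul_le_mul_of_nonneg_right ((toReal S).le_opNorm (u n)) (norm_nonneg (v n))).trans_eq
      (mul_assoc _ _ _)
  hasSum x := by
    simpa only [toReal_apply, map_smul, ContinuousLinearMap.comp_apply] using
      (h.hasSum x).mapL (toReal S)

theorem IsNuclearRep.summable_prod (h : IsNuclearRep u v T) (hb : IsQBasis b) :
    Summable fun p : κ × ι => qinner (b p.2) (u p.1) * qinner (v p.1) (b p.2) := by
  have hle : ∀ n, ∃ C ≤ ‖u n‖ * ‖v n‖,
      HasSum (fun k => ‖qinner (b k) (u n) * qinner (v n) (b k)‖) C := fun n => by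
    simpa only [norm_mul, norm_qinner_comm (v n)] using exists_hasSum_mul_le_of_hasSum_sq
      (norm_nonneg _) (norm_nonneg _) (fun k => norm_nonneg _) (fun k => norm_nonneg _)
      (hb.hasSum_norm_qinner_sq (u n)) (hb.hasSum_norm_qinner_sq (v n))
  choose C hC hsum using hle
  refine .of_norm <| (summable_prod_of_nonneg fun p => norm_nonneg _).2
    ⟨fun n => (hsum n).summable, h.summable.of_nonneg_of_le
      (fun n => tsum_nonneg fun k => norm_nonneg _) fun n => (hsum n).tsum_eq.trans_le (hC n)⟩

theorem IsNuclearRep.hasSum_re_qinner_basis (h : IsNuclearRep u v T) (hb : IsQBasis b) :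
    HasSum (fun k => (qinner (b k) (T (b k))).re) (∑' n, (qinner (v n) (u n)).re) := by
  have hs := (h.summable_prod hb).mapL reL
  have hrow : ∀ n, HasSum (fun k => reL (qinner (b k) (u n) * qinner (v n) (b k)))
      (qinner (v n) (u n)).re := fun n => by
    convert (hb.hasSum_qinner (v n) (u n)).mapL reL using 1
    · ext k
      simp [mul_comm]
    · rw [reL_apply]
  have hcol : ∀ k, HasSum (fun n => reL (qinner (b k) (u n) * qinner (v n) (b k)))
      (qinner (b k) (T (b k))).re := fun k => by
    simpa only [reL_apply] using (h.hasSum_qinner (b k) (b k)).mapL reL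
  rw [(hs.hasSum.prod_fiberwise hrow).tsum_eq]
  exact ((Equiv.prodComm ι κ).hasSum_iff.2 hs.hasSum).prod_fiberwise hcol

theorem IsSingularValueSeq.exists_isNuclearRep {s : ℕ → ℝ} (h : IsSingularValueSeq T s)
    (hs : Summable s) : ∃ u v : ℕ → H, IsNuclearRep u v T := by
  obtain ⟨P, hP, e, he, hPe, hsum⟩ := h.exists_eigenvectors
  refine ⟨fun n => T (e n), e, ?_, fun x => ?_⟩
  · refine hs.of_nonneg_of_le (fun n => by positivity) fun n => ?_
    calc ‖T (e n)‖ * ‖e n‖ = s n * (‖e n‖ * ‖e n‖) := by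
          rw [← hP.norm_eq, hPe, norm_op_smul, Quaternion.norm_coe,
            Real.norm_of_nonneg (h.2.1 n), mul_assoc]
      _ ≤ s n := mul_le_of_le_one_right (h.2.1 n) (mul_le_one₀ (he n) (norm_nonneg _) (he n))
  · have hPx : HasSum (fun n => P (op (qinner (e n) x) • e n)) (P x) := by
      simpa only [map_smul, hPe, smul_smul, ← MulOpposite.op_mul] using hsum x
    simpa only [AddMonoidHom.coe_coe, map_smul] using
      hasSum_map_of_norm_eq (f := (P : H →+ H)) (g := (T : H →+ H)) hP.norm_eq hPx

/-- The operator `∑ₙ eₙ ⟨eₙ, ·⟩` over `n ∈ s`, which for an orthonormal family `e` is the orthogonal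
projection onto the span of the `eₙ` with `n ∈ s`. -/
def spanProj (e : ι → H) (s : Finset ι) : H →L[ℍᵐᵒᵖ] H :=
  ∑ n ∈ s, rankOne (e n) (e n)

theorem spanProj_apply (e : ι → H) (s : Finset ι) (x : H) :
    spanProj e s x = ∑ n ∈ s, op (qinner (e n) x) • e n := by
  simp only [spanProj, sum_apply, rankOne_apply]

theorem qinner_spanProj (e : ι → H) (s : Finset ι) (x y : H) :
    qinner (spanProj e s x) y = qinner x (spanProj e s y) := by
  simp only [spanProj_apply, qinner_sum_left, qinner_sum_right, qinner_smul_left,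
    qinner_smul_right, star_qinner]

theorem isNuclearRep_spanProj (e : ι → H) (s : Finset ι) :
    IsNuclearRep (fun n : s => e n) (fun n : s => e n) (spanProj e s) where
  summable := .of_finite
  hasSum x := by
    rw [spanProj_apply, ← Finset.sum_coe_sort]
    exact hasSum_fintype _

theorem QOrthonormal.spanProj_apply_self {e : ι → H} (he : QOrthonormal e) {s : Finset ι} {n : ι}
    (hn : n ∈ s) : spanProj e s (e n) = e n := by
  rw [spanProj_apply, Finset.sum_eq_single_of_mem n hn fun m _ hmn => ?_, he.self,
    MulOpposite.op_one, one_smul]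
  rw [he.orthogonal m n hmn, MulOpposite.op_zero, zero_smul]

end Nuclear

section Coefficients

variable {H : Type*} [NormedAddCommGroup H] [Module ℍᵐᵒᵖ H] [QuaternionicInner H] {ι : Type*}
  {b : ι → H}

attribute [local instance] realInnerProductSpace

theorem QOrthonormal.injective (hb : QOrthonormal b) : Function.Injective b := fun k l hkl => by
  by_contra hne
  have h := hb.orthogonal k l hne
  rw [← hkl, hb.self] at h
  exact one_ne_zero h

theorem QOrthonormal.qinner_eq_of_hasSum (hb : QOrthonormal b) {a : ι → ℍ} {x : H}
    (h : HasSum (fun k => op (a k) • b k) x) (k : ι) : qinner (b k) x = a k := by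
  have hk : HasSum (fun l => qinner (b k) (op (a l) • b l)) (qinner (b k) (op (a k) • b k)) :=
    hasSum_single k fun l hl => by
      rw [qinner_smul_right, hb.orthogonal k l hl.symm, zero_mul]
  rw [qinner_smul_right, hb.self, one_mul] at hk
  exact (h.mapL (qinnerL (b k))).unique hk

theorem re_qinner_sum_smul (s : Finset ι) (x : H) (a : ι → ℍ)
    (hx : ∀ k ∈ s, qinner (b k) x = a k) :
    (qinner (∑ k ∈ s, op (a k) • b k) x).re = ∑ k ∈ s, ‖a k‖ ^ 2 := by
  rw [qinner_sum_left, ← reL_apply, map_sum]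
  refine Finset.sum_congr rfl fun k hk => ?_
  rw [qinner_smul_left, hx k hk, Quaternion.star_mul_self, reL_apply, Quaternion.re_coe,
    normSq_eq_norm_mul_self, sq]

theorem QOrthonormal.norm_sum_sq (hb : QOrthonormal b) (s : Finset ι) (a : ι → ℍ) :
    ‖∑ k ∈ s, op (a k) • b k‖ ^ 2 = ∑ k ∈ s, ‖a k‖ ^ 2 := by
  classical
  rw [← re_qinner_self]
  refine re_qinner_sum_smul s _ a fun k hk => ?_
  rw [qinner_sum_right, Finset.sum_eq_single_of_mem k hk fun l _ hl => by
    rw [qinner_smul_right, hb.orthogonal k l hl.symm, zero_mul],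
    qinner_smul_right, hb.self, one_mul]

/-- Bessel's inequality, from the Cauchy–Schwarz inequality between `x` and its projection. -/
theorem QOrthonormal.summable_norm_qinner_sq (hb : QOrthonormal b) (x : H) :
    Summable fun k => ‖qinner (b k) x‖ ^ 2 := by
  refine summable_of_sum_le (c := ‖x‖ ^ 2) (fun _ => sq_nonneg _) fun s => ?_
  have hCS := real_inner_le_norm (∑ k ∈ s, op (qinner (b k) x) • b k) x
  rw [real_inner_def, re_qinner_sum_smul s x _ fun _ _ => rfl] at hCS
  nlinarith [hb.norm_sum_sq s fun k => qinner (b k) x,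
    sq_nonneg (‖∑ k ∈ s, op (qinner (b k) x) • b k‖ - ‖x‖)]

theorem QOrthonormal.cauchySeq_sum_smul (hb : QOrthonormal b) {a : ι → ℍ}
    (ha : Summable fun k => ‖a k‖ ^ 2) :
    CauchySeq fun s : Finset ι => ∑ k ∈ s, op (a k) • b k := by
  refine cauchySeq_finset_iff_vanishing_norm.2 fun ε hε => ?_
  obtain ⟨s, hs⟩ := summable_iff_vanishing_norm.1 ha (ε ^ 2) (by positivity)
  refine ⟨s, fun t ht => lt_of_pow_lt_pow_left₀ 2 hε.le ?_⟩
  rw [hb.norm_sum_sq]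
  exact (le_abs_self _).trans_lt (hs t ht)

theorem QOrthonormal.isQBasis (hb : QOrthonormal b)
    (hext : ∀ x y, (∀ k, qinner (b k) x = qinner (b k) y) → x = y)
    (hsum : ∀ a : ι → ℍ, (Summable fun k => ‖a k‖ ^ 2) → Summable fun k => op (a k) • b k) :
    IsQBasis b where
  toQOrthonormal := hb
  hasSum x := by
    have h := (hsum _ (hb.summable_norm_qinner_sq x)).hasSum
    rwa [hext _ x (hb.qinner_eq_of_hasSum h)] at h

theorem IsQBasis.completeSpace (hb : IsQBasis b)
    (hsum : ∀ a : ι → ℍ, (Summable fun k => ‖a k‖ ^ 2) → Summable fun k => op (a k) • b k) :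
    CompleteSpace H := by
  let Φ : H →+ lp (fun _ : ι => ℍ) 2 :=
    { toFun := fun x => ⟨fun k => qinner (b k) x,
        memℓp_gen (by simpa using (hb.hasSum_norm_qinner_sq x).summable)⟩
      map_zero' := by ext k : 2; exact qinner_zero_right _
      map_add' := fun x y => by ext k : 2; exact qinner_add_right _ _ _ }
  have hΦ : Isometry Φ := AddMonoidHomClass.isometry_of_norm _ fun x => by
    have h := lp.norm_rpow_eq_tsum (p := 2) (by norm_num) (Φ x)
    simp only [ENNReal.toReal_ofNat, Real.rpow_two] at h
    rw [← sq_eq_sq₀ (norm_nonneg _) (norm_nonneg _), ← (hb.hasSum_norm_qinner_sq x).tsum_eq, h]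
    rfl
  have hsurj : Function.Surjective Φ := fun a => by
    have ha := (lp.memℓp a).summable (by norm_num)
    refine ⟨∑' k, op (a k) • b k, ?_⟩
    ext k : 2
    exact hb.qinner_eq_of_hasSum (hsum a (by simpa using ha)).hasSum k
  rw [completeSpace_iff_isComplete_range hΦ.isUniformInducing, hsurj.range_eq]
  exact isComplete_univ

end Coefficients

section Deflation

variable {H : Type*} [NormedAddCommGroup H] [Module ℍᵐᵒᵖ H] [QuaternionicInner H] {ι : Type*}
  {T : H →L[ℍᵐᵒᵖ] H}

attribute [local instance] realInnerProductSpace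

/-- A positive compact operator. -/
structure IsCompactPositive (T : H →L[ℍᵐᵒᵖ] H) : Prop where
  isPositive : IsPositive T
  isCompactOperator : IsCompactOperator T

/-- The largest eigenvalue of a positive compact operator, which is its norm. -/
def topValue (T : H →L[ℍᵐᵒᵖ] H) : ℝ := ‖toReal T‖

open Classical in
/-- A unit eigenvector for the largest eigenvalue, or zero if there is none. -/
def topVector (T : H →L[ℍᵐᵒᵖ] H) : H :=
  if h : ∃ x, ‖x‖ = 1 ∧ T x = op (topValue T : ℍ) • x then h.choose else 0

theorem topValue_nonneg (T : H →L[ℍᵐᵒᵖ] H) : 0 ≤ topValue T := norm_nonneg _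

theorem norm_apply_le_topValue (T : H →L[ℍᵐᵒᵖ] H) (x : H) : ‖T x‖ ≤ topValue T * ‖x‖ :=
  (toReal T).le_opNorm x

theorem apply_topVector (T : H →L[ℍᵐᵒᵖ] H) :
    T (topVector T) = op (topValue T : ℍ) • topVector T := by
  unfold topVector
  split_ifs with h
  · exact h.choose_spec.2
  · rw [map_zero, smul_zero]

theorem norm_topVector_le (T : H →L[ℍᵐᵒᵖ] H) : ‖topVector T‖ ≤ 1 := by
  unfold topVector
  split_ifs with h
  · exact h.choose_spec.1.le
  · rw [norm_zero]; exact zero_le_one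

theorem IsCompactPositive.norm_topVector [CompleteSpace H] (hT : IsCompactPositive T)
    (h0 : topValue T ≠ 0) : ‖topVector T‖ = 1 := by
  obtain ⟨x, hx, hx0⟩ := (hasEigenvalue_norm_of_isPositive hT.isPositive.isPositive_toReal
    hT.isCompactOperator (norm_ne_zero_iff.1 h0)).exists_hasEigenvector
  have hTx : T x = topValue T • x := Module.End.mem_eigenspace_iff.1 hx
  have h : ∃ x, ‖x‖ = 1 ∧ T x = op (topValue T : ℍ) • x := by
    refine ⟨‖x‖⁻¹ • x, norm_smul_inv_norm (𝕜 := ℝ) hx0, ?_⟩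
    rw [← toReal_apply, map_smul, toReal_apply, hTx, smul_comm, real_smul_def (topValue T)]
  rw [topVector, dif_pos h]
  exact h.choose_spec.1

theorem IsCompactPositive.qinner_topVector_self [CompleteSpace H] (hT : IsCompactPositive T)
    (h0 : topValue T ≠ 0) : qinner (topVector T) (topVector T) = 1 :=
  qinner_self_eq_one.2 (hT.norm_topVector h0)

theorem IsPositive.qinner_topVector_apply (hT : IsPositive T) (x : H) :
    qinner (topVector T) (T x) = (topValue T : ℍ) * qinner (topVector T) x := by
  rw [← hT.selfAdjoint, apply_topVector, qinner_smul_left, Quaternion.star_coe]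

/-- The operator that agrees with `T` on the orthogonal complement of `topVector T` and vanishes on
`topVector T`. -/
def deflate (T : H →L[ℍᵐᵒᵖ] H) : H →L[ℍᵐᵒᵖ] H :=
  T - rankOne (T (topVector T)) (topVector T)

theorem deflate_apply (T : H →L[ℍᵐᵒᵖ] H) (x : H) :
    deflate T x = T x - op ((topValue T : ℍ) * qinner (topVector T) x) • topVector T := by
  rw [deflate, sub_apply, rankOne_apply, apply_topVector, smul_smul,
    ← MulOpposite.op_mul]

theorem deflate_apply' (T : H →L[ℍᵐᵒᵖ] H) (x : H) :
    deflate T x = T (x - op (qinner (topVector T) x) • topVector T) := by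
  rw [deflate, sub_apply, rankOne_apply, map_sub, map_smul]

theorem IsCompactPositive.deflate_topVector [CompleteSpace H] (hT : IsCompactPositive T) :
    deflate T (topVector T) = 0 := by
  rcases eq_or_ne (topValue T) 0 with h0 | h0
  · simp [deflate_apply, apply_topVector, h0]
  · rw [deflate_apply, apply_topVector, hT.qinner_topVector_self h0, mul_one, sub_self]

theorem IsCompactPositive.qinner_topVector_deflate [CompleteSpace H] (hT : IsCompactPositive T)
    (x : H) : qinner (topVector T) (deflate T x) = 0 := by
  rw [deflate_apply', hT.isPositive.qinner_topVector_apply, qinner_sub_right, qinner_smul_right,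
    mul_sub, ← mul_assoc, sub_eq_zero]
  rcases eq_or_ne (topValue T) 0 with h0 | h0
  · simp [h0]
  · rw [hT.qinner_topVector_self h0, mul_one]

theorem re_qinner_deflate (T : H →L[ℍᵐᵒᵖ] H) (x : H) :
    (qinner x (deflate T x)).re =
      (qinner x (T x)).re - topValue T * ‖qinner (topVector T) x‖ ^ 2 := by
  have h : qinner x (topVector T) * (↑(topValue T) * qinner (topVector T) x) =
      topValue T • (‖qinner (topVector T) x‖ ^ 2 : ℝ) := by
    rw [Quaternion.coe_mul_eq_smul, mul_smul_comm, ← star_qinner x, Quaternion.star_mul_self,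
      normSq_eq_norm_mul_self, ← sq]
  rw [deflate_apply, qinner_sub_right, qinner_smul_right, h, Quaternion.re_sub, Quaternion.re_smul,
    Quaternion.re_coe, smul_eq_mul]

protected theorem IsCompactPositive.deflate [CompleteSpace H] (hT : IsCompactPositive T) :
    IsCompactPositive (deflate T) where
  isPositive x := by
    obtain ⟨r, hr, h⟩ := hT.isPositive (x - op (qinner (topVector T) x) • topVector T)
    refine ⟨r, hr, ?_⟩
    rw [← h, ← deflate_apply', ← star_qinner, ← star_qinner (x - _), qinner_sub_right,
      qinner_smul_right, ← star_qinner _ (topVector T), hT.qinner_topVector_deflate]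
    simp
  isCompactOperator := hT.isCompactOperator.sub (isCompactOperator_rankOne _ _)

theorem IsPositive.deflate_apply_eq_zero (hT : IsPositive T) {x : H} (hx : T x = 0) :
    deflate T x = 0 := by
  rw [deflate_apply, ← hT.qinner_topVector_apply, hx]
  simp

theorem IsCompactPositive.topValue_deflate_le [CompleteSpace H] (hT : IsCompactPositive T) :
    topValue (deflate T) ≤ topValue T := by
  set D := deflate T with hD
  rcases eq_or_ne (topValue D) 0 with h0 | h0
  · exact h0.trans_le (topValue_nonneg T)
  set f := topVector D
  have hf : ‖f‖ = 1 := hT.deflate.norm_topVector h0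
  calc topValue D = (qinner f (D f)).re := by
        rw [apply_topVector, qinner_smul_right, qinner_self_eq_one.2 hf, one_mul,
          Quaternion.re_coe]
    _ ≤ (qinner f (T f)).re := by
        rw [hD, re_qinner_deflate]
        linarith [mul_nonneg (topValue_nonneg T) (sq_nonneg ‖qinner (topVector T) f‖)]
    _ ≤ ‖f‖ * ‖T f‖ := (real_inner_le_norm f (T f))
    _ ≤ topValue T := by simpa [hf] using norm_apply_le_topValue T f

/-- The operator obtained from `T` by splitting off its `n` largest eigenvalues. -/
def deflation (T : H →L[ℍᵐᵒᵖ] H) (n : ℕ) : H →L[ℍᵐᵒᵖ] H := deflate^[n] T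

/-- The eigenvalues of a positive compact operator in decreasing order. -/
def eigenvalueSeq (T : H →L[ℍᵐᵒᵖ] H) (n : ℕ) : ℝ := topValue (deflation T n)

/-- Orthonormal eigenvectors for the nonzero terms of `eigenvalueSeq T`. -/
def eigenvectorSeq (T : H →L[ℍᵐᵒᵖ] H) (n : ℕ) : H := topVector (deflation T n)

theorem eigenvalueSeq_nonneg (T : H →L[ℍᵐᵒᵖ] H) (n : ℕ) : 0 ≤ eigenvalueSeq T n :=
  topValue_nonneg _

theorem norm_deflation_apply_le (T : H →L[ℍᵐᵒᵖ] H) (n : ℕ) (x : H) :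
    ‖deflation T n x‖ ≤ eigenvalueSeq T n * ‖x‖ :=
  norm_apply_le_topValue _ x

theorem deflation_succ (T : H →L[ℍᵐᵒᵖ] H) (n : ℕ) :
    deflation T (n + 1) = deflate (deflation T n) :=
  Function.iterate_succ_apply' _ _ _

protected theorem IsCompactPositive.deflation [CompleteSpace H] (hT : IsCompactPositive T) (n : ℕ) :
    IsCompactPositive (deflation T n) := by
  induction n with
  | zero => exact hT
  | succ n ih => rw [deflation_succ]; exact ih.deflate

theorem IsCompactPositive.antitone_eigenvalueSeq [CompleteSpace H] (hT : IsCompactPositive T) :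
    Antitone (eigenvalueSeq T) :=
  antitone_nat_of_succ_le fun n => by
    rw [eigenvalueSeq, deflation_succ]
    exact (hT.deflation n).topValue_deflate_le

theorem IsCompactPositive.deflation_eigenvectorSeq [CompleteSpace H] (hT : IsCompactPositive T)
    {m n : ℕ} (hmn : m < n) : deflation T n (eigenvectorSeq T m) = 0 := by
  induction n, hmn using Nat.le_induction with
  | base => rw [deflation_succ]; exact (hT.deflation m).deflate_topVector
  | succ n _ ih =>
    rw [deflation_succ]
    exact (hT.deflation n).isPositive.deflate_apply_eq_zero ih

theorem IsCompactPositive.qinner_eigenvectorSeq_of_lt [CompleteSpace H]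
    (hT : IsCompactPositive T) {m n : ℕ} (hmn : m < n) (hn : eigenvalueSeq T n ≠ 0) :
    qinner (eigenvectorSeq T n) (eigenvectorSeq T m) = 0 := by
  have h := (hT.deflation n).isPositive.qinner_topVector_apply (eigenvectorSeq T m)
  rw [hT.deflation_eigenvectorSeq hmn, qinner_zero_right, eq_comm, mul_eq_zero] at h
  exact h.resolve_left fun h0 => hn (Quaternion.coe_injective h0)

theorem IsCompactPositive.qinner_eigenvectorSeq [CompleteSpace H] (hT : IsCompactPositive T)
    {m n : ℕ} (hm : eigenvalueSeq T m ≠ 0) (hn : eigenvalueSeq T n ≠ 0) :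
    qinner (eigenvectorSeq T m) (eigenvectorSeq T n) = if m = n then 1 else 0 := by
  split_ifs with h
  · rw [h]
    exact (hT.deflation n).qinner_topVector_self hn
  rcases lt_or_gt_of_ne h with hmn | hmn
  · rw [← star_qinner, hT.qinner_eigenvectorSeq_of_lt hmn hn, star_zero]
  · exact hT.qinner_eigenvectorSeq_of_lt hmn hm

theorem sum_eigenvectorSeq (T : H →L[ℍᵐᵒᵖ] H) (n : ℕ) (x : H) :
    ∑ k ∈ Finset.range n,
      op ((eigenvalueSeq T k : ℍ) * qinner (eigenvectorSeq T k) x) • eigenvectorSeq T k =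
      T x - deflation T n x := by
  induction n with
  | zero => simp [deflation]
  | succ n ih =>
    rw [Finset.sum_range_succ, ih, deflation_succ, deflate_apply, eigenvalueSeq, eigenvectorSeq]
    abel

theorem sum_eigenvalueSeq_mul_norm_sq (T : H →L[ℍᵐᵒᵖ] H) (n : ℕ) (x : H) :
    ∑ k ∈ Finset.range n, eigenvalueSeq T k * ‖qinner (eigenvectorSeq T k) x‖ ^ 2 =
      (qinner x (T x)).re - (qinner x (deflation T n x)).re := by
  induction n with
  | zero => simp [deflation]
  | succ n ih =>
    rw [Finset.sum_range_succ, ih, deflation_succ, re_qinner_deflate, eigenvalueSeq,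
      eigenvectorSeq]
    ring

theorem IsCompactPositive.isSingularValueSeq [CompleteSpace H] (hT : IsCompactPositive T)
    (hs : Summable (eigenvalueSeq T)) : IsSingularValueSeq T (eigenvalueSeq T) := by
  refine ⟨hT.antitone_eigenvalueSeq, eigenvalueSeq_nonneg T, T, hT.isPositive.isAbs,
    eigenvectorSeq T, fun m n hm hn => hT.qinner_eigenvectorSeq hm hn, fun x => ?_⟩
  have hsum : Summable fun n =>
      op ((eigenvalueSeq T n : ℍ) * qinner (eigenvectorSeq T n) x) • eigenvectorSeq T n := by
    refine (hs.mul_right ‖x‖).of_norm_bounded fun n => ?_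
    have he : ‖eigenvectorSeq T n‖ ≤ 1 := norm_topVector_le _
    rw [norm_op_smul, norm_mul, Quaternion.norm_coe,
      Real.norm_of_nonneg (eigenvalueSeq_nonneg T n), mul_assoc]
    refine mul_le_mul_of_nonneg_left ?_ (eigenvalueSeq_nonneg T n)
    calc ‖qinner (eigenvectorSeq T n) x‖ * ‖eigenvectorSeq T n‖
        ≤ ‖eigenvectorSeq T n‖ * ‖x‖ * ‖eigenvectorSeq T n‖ := by
          gcongr; exact norm_qinner_le _ _
      _ ≤ 1 * ‖x‖ * 1 := by gcongr
      _ = ‖x‖ := by ring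
  have hlim : Tendsto (fun n => deflation T n x) atTop (𝓝 0) :=
    squeeze_zero_norm (fun n => norm_deflation_apply_le T n x)
      (by simpa only [zero_mul] using hs.tendsto_atTop_zero.mul_const ‖x‖)
  refine hsum.hasSum_iff_tendsto_nat.2 ?_
  simpa only [sum_eigenvectorSeq, sub_zero] using hlim.const_sub (T x)

theorem IsCompactPositive.eigenvalueSeq_mul_norm_sq [CompleteSpace H] (hT : IsCompactPositive T)
    (n : ℕ) : eigenvalueSeq T n * ‖eigenvectorSeq T n‖ ^ 2 = eigenvalueSeq T n := by
  rcases eq_or_ne (eigenvalueSeq T n) 0 with h0 | h0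
  · rw [h0, zero_mul]
  · rw [eigenvectorSeq, (hT.deflation n).norm_topVector h0, one_pow, mul_one]

theorem IsCompactPositive.summable_eigenvalueSeq [CompleteSpace H] (hT : IsCompactPositive T)
    {b : ι → H} (hb : IsQBasis b) (hsum : Summable fun k => (qinner (b k) (T (b k))).re) :
    Summable (eigenvalueSeq T) := by
  refine summable_of_sum_range_le (c := ∑' k, (qinner (b k) (T (b k))).re)
    (eigenvalueSeq_nonneg T) fun n => ?_
  have hParseval : ∀ m, HasSum
      (fun k => eigenvalueSeq T m * ‖qinner (eigenvectorSeq T m) (b k)‖ ^ 2)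
      (eigenvalueSeq T m) := fun m => by
    simpa only [norm_qinner_comm (b _), hT.eigenvalueSeq_mul_norm_sq] using
      (hb.hasSum_norm_qinner_sq (eigenvectorSeq T m)).mul_left (eigenvalueSeq T m)
  refine hasSum_le (fun k => ?_) (hasSum_sum fun m _ => hParseval m) hsum.hasSum
  rw [sum_eigenvalueSeq_mul_norm_sq]
  exact sub_le_self _ ((hT.deflation n).isPositive.re_nonneg (b k))

theorem IsPositive.memTraceClass_of_summable [CompleteSpace H] {J : H →L[ℍᵐᵒᵖ] H}
    (hT : IsPositive T) (hJ : CommutesWith J T) {b : ι → H} (hb : IsQBasis b)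
    (hsum : Summable fun k => (qinner (b k) (T (b k))).re) : MemTraceClass J T :=
  have hc : IsCompactPositive T := ⟨hT, hb.isCompactOperator_of_isPositive hT hsum⟩
  have hs := hc.summable_eigenvalueSeq hb hsum
  ⟨hc.isCompactOperator, hJ, eigenvalueSeq T, hc.isSingularValueSeq hs, hs⟩

end Deflation

section ImagUnit

variable (i : ImagUnit)

theorem star_imagUnit : star (i : ℍ) = -i := by
  ext <;> simp [i.2.1]

theorem imagUnit_mul_self : (i : ℍ) * i = -1 := by
  have h : star (i : ℍ) * i = 1 := by
    rw [Quaternion.star_mul_self, normSq_eq_norm_mul_self, i.2.2, mul_one, Quaternion.coe_one]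
  rw [← h, star_imagUnit, neg_mul, neg_neg]

theorem imagUnit_ne_zero : (i : ℍ) ≠ 0 :=
  norm_ne_zero_iff.1 (i.2.2.trans_ne one_ne_zero)

/-- If `s` does not commute with `i`, then `i s - s i` anticommutes with `i`. -/
theorem exists_anticommute : ∃ a : ℍ, a ≠ 0 ∧ (i : ℍ) * a = -(a * i) := by
  by_contra! h
  have hcomm : ∀ s : ℍ, (i : ℍ) * s = s * i := fun s => by
    by_contra hs
    refine h (i * s - s * i) (sub_ne_zero.2 hs) ?_
    rw [mul_sub, sub_mul, mul_assoc s, ← mul_assoc (i : ℍ) i, imagUnit_mul_self]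
    noncomm_ring
  have h0 := Quaternion.ext_iff.1 (hcomm (stdUnit 0))
  have h1 := Quaternion.ext_iff.1 (hcomm (stdUnit 1))
  simp only [re_mul, stdUnit_re, mul_zero, stdUnit_imI, ↓reduceIte, mul_one,
    zero_sub, stdUnit_imJ, zero_ne_one, sub_zero, stdUnit_imK, Fin.reduceEq, zero_mul, one_mul,
    imI_mul, add_zero, zero_add, imJ_mul, sub_self, imK_mul, true_and, one_ne_zero] at h0 h1
  exact imagUnit_ne_zero i (Quaternion.ext_iff.2
    ⟨i.2.1, by simp only [Quaternion.imI_zero]; linarith,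
      by simp only [Quaternion.imJ_zero]; linarith, by simp only [Quaternion.imK_zero]; linarith⟩)

theorem eq_re_sub_re_mul_of_commute {q : ℍ} (hq : (i : ℍ) * q = q * i) :
    q = q.re • (1 : ℍ) - (q * i).re • (i : ℍ) := by
  have hre : ∀ p : ℍ, p.re • (1 : ℍ) = (2⁻¹ : ℝ) • (p + star p) := fun p => by
    rw [Quaternion.self_add_star', Quaternion.smul_coe, inv_mul_cancel_left₀ two_ne_zero,
      ← Quaternion.coe_one, Quaternion.smul_coe, mul_one]
  have hqi : star (q * i) = -(star q * i) := by
    rw [← hq, star_mul, star_imagUnit, mul_neg]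
  calc q = (2⁻¹ : ℝ) • (q + star q) - (2⁻¹ : ℝ) • (q * i - star q * i) * i := by
        rw [smul_mul_assoc, sub_mul, mul_assoc, mul_assoc, imagUnit_mul_self]
        simp only [mul_neg, mul_one]
        module
    _ = q.re • (1 : ℍ) - (q * i).re • (i : ℍ) := by
        rw [hre, ← one_mul (i : ℍ), ← smul_mul_assoc (q * (1 * (i : ℍ))).re, one_mul, hre, hqi,
          sub_eq_add_neg (q * (i : ℍ))]

end ImagUnit

section PlusSpace

variable {H : Type*} [NormedAddCommGroup H] [Module ℍᵐᵒᵖ H] {J T : H →L[ℍᵐᵒᵖ] H}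
  {i : ImagUnit} {x y : H}

theorem op_imagUnit_smul_smul (i : ImagUnit) (x : H) : op (i : ℍ) • op (i : ℍ) • x = -x := by
  rw [smul_smul, ← MulOpposite.op_mul, imagUnit_mul_self, MulOpposite.op_neg, MulOpposite.op_one,
    neg_smul, one_smul]

theorem sub_smul_apply_mem_plusSpace (hJ : ∀ x, J (J x) = -x) (x : H) :
    x - op (i : ℍ) • J x ∈ plusSpace J i := by
  change J (x - op (i : ℍ) • J x) = op (i : ℍ) • (x - op (i : ℍ) • J x)
  rw [map_sub, map_smul, hJ, smul_sub, op_imagUnit_smul_smul, smul_neg, sub_neg_eq_add,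
    sub_neg_eq_add, add_comm]

theorem apply_add_smul_apply (hJ : ∀ x, J (J x) = -x) (x : H) :
    J (x + op (i : ℍ) • J x) = -(op (i : ℍ) • (x + op (i : ℍ) • J x)) := by
  rw [map_add, map_smul, hJ, smul_add, op_imagUnit_smul_smul, smul_neg]
  abel

theorem smul_mem_plusSpace_of_anticommute {a : ℍ} (ha : (i : ℍ) * a = -(a * i))
    (hx : J x = -(op (i : ℍ) • x)) : op a • x ∈ plusSpace J i := by
  change J (op a • x) = op (i : ℍ) • op a • x
  rw [map_smul, hx, smul_neg, smul_smul, smul_smul, ← MulOpposite.op_mul, ← MulOpposite.op_mul,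
    ha, MulOpposite.op_neg, neg_smul, neg_neg]

theorem CommutesWith.apply_mem_plusSpace (hT : CommutesWith J T) (hx : x ∈ plusSpace J i) :
    T x ∈ plusSpace J i := by
  change J (T x) = op (i : ℍ) • T x
  rw [← hT, show J x = _ from hx, map_smul]

variable [QuaternionicInner H] {κ : Type*} {u v : κ → H}

attribute [local instance] realInnerProductSpace

theorem qinner_commute_of_mem_plusSpace (hJ : IsAntiSelfAdjoint J)
    (hx : x ∈ plusSpace J i) (hy : y ∈ plusSpace J i) :
    (i : ℍ) * qinner x y = qinner x y * i := by
  have h := hJ x y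
  rw [show J x = _ from hx, show J y = _ from hy, qinner_neg_left, qinner_smul_left,
    qinner_smul_right, star_imagUnit, neg_mul, neg_neg] at h
  exact h

/-- Every `x` is the sum of `(x - (J x) i) / 2` in `H₊` and `(x + (J x) i) / 2` in `H₋`, and right
multiplication by a quaternion that anticommutes with `i` maps `H₋` onto `H₊`. -/
theorem IsPlusBasis.isQBasis {b : Set H} (hb : IsPlusBasis J i b) (hJ : ∀ x, J (J x) = -x) :
    IsQBasis fun e : b => (e : H) where
  self e := hb.2.1 e e.2
  orthogonal e e' h := hb.2.2.1 e e.2 e' e'.2 fun h' => h (Subtype.ext h')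
  hasSum x := by
    let HasFourier : H → Prop := fun x => HasSum (fun e : b => op (qinner (e : H) x) • (e : H)) x
    have hadd : ∀ {x y}, HasFourier x → HasFourier y → HasFourier (x + y) := fun hx hy => by
      simpa only [HasFourier, qinner_add_right, MulOpposite.op_add, add_smul] using hx.add hy
    have hsmul : ∀ (a : ℍ) {x}, HasFourier x → HasFourier (op a • x) := fun a x hx => by
      simpa only [HasFourier, qinner_smul_right, MulOpposite.op_mul, mul_smul] using
        hx.const_smul (op a)
    have hplus : ∀ {x}, x ∈ plusSpace J i → HasFourier x := fun hx => hb.2.2.2 _ hx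
    obtain ⟨a, ha0, ha⟩ := exists_anticommute i
    have hminus : HasFourier (x + op (i : ℍ) • J x) := by
      have h := hsmul a⁻¹ (hplus (smul_mem_plusSpace_of_anticommute ha (apply_add_smul_apply hJ x)))
      rwa [smul_smul, ← MulOpposite.op_mul, mul_inv_cancel₀ ha0, MulOpposite.op_one,
        one_smul] at h
    have hx : x = op ((2⁻¹ : ℝ) : ℍ) • ((x - op (i : ℍ) • J x) + (x + op (i : ℍ) • J x)) := by
      rw [sub_add_add_cancel, ← real_smul_def]
      module
    rw [hx]
    exact hsmul _ (hadd (hplus (sub_smul_apply_mem_plusSpace hJ x)) hminus)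

theorem IsNuclearRep.hasTrace (h : IsNuclearRep u v T) (hJ : ∀ x, J (J x) = -x)
    (hJa : IsAntiSelfAdjoint J) (hTJ : CommutesWith J T) (hb : ∃ b : Set H, IsPlusBasis J i b)
    {t : ℍ} (ht : (i : ℍ) * t = t * i) (hre : ∑' n, (qinner (v n) (u n)).re = t.re)
    (him : ∑' n, (qinner (-J (v n)) (u n)).re = (t * i).re) : HasTrace J i T t := by
  refine ⟨hb, fun b hb => ?_⟩
  have hcoord : ∀ e : b, qinner (e : H) (T e) =
      (qinner (e : H) (T e)).re • (1 : ℍ) - (qinner (e : H) (T (J e))).re • (i : ℍ) := fun e => by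
    rw [show J e = _ from hb.1 e.2, map_smul, qinner_smul_right]
    exact eq_re_sub_re_mul_of_commute i
      (qinner_commute_of_mem_plusSpace hJa (hb.1 e.2) (hTJ.apply_mem_plusSpace (hb.1 e.2)))
  have hT := h.hasSum_re_qinner_basis (hb.isQBasis hJ)
  have hTJ := (h.comp (A := -J) hJa).hasSum_re_qinner_basis (hb.isQBasis hJ)
  simp only [neg_apply, him] at hTJ
  rw [hre] at hT
  rw [eq_re_sub_re_mul_of_commute i ht, funext hcoord]
  exact (hT.smul_const (1 : ℍ)).sub (hTJ.smul_const (i : ℍ))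

end PlusSpace

section SlicePlane

variable (i : ImagUnit)

/-- The identification `slicePt i` of `ℂ` with `ℂ_i` as a homomorphism of real algebras. -/
def sliceHom : ℂ →ₐ[ℝ] ℍ :=
  Complex.lift ⟨i, imagUnit_mul_self i⟩

theorem sliceHom_apply (z : ℂ) : sliceHom i z = slicePt i z := by
  rw [sliceHom, Complex.lift_apply, Complex.liftAux_apply, slicePt, Quaternion.algebraMap_def,
    Quaternion.mul_coe_eq_smul]

theorem slicePt_zero : slicePt i 0 = 0 := by
  simp only [← sliceHom_apply, map_zero]

theorem slicePt_one : slicePt i 1 = 1 := by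
  simp only [← sliceHom_apply, map_one]

theorem slicePt_add (z w : ℂ) : slicePt i (z + w) = slicePt i z + slicePt i w := by
  simp only [← sliceHom_apply, map_add]

theorem slicePt_mul (z w : ℂ) : slicePt i (z * w) = slicePt i z * slicePt i w := by
  simp only [← sliceHom_apply, map_mul]

theorem slicePt_comm (z w : ℂ) : slicePt i z * slicePt i w = slicePt i w * slicePt i z := by
  rw [← slicePt_mul, mul_comm, slicePt_mul]

theorem slicePt_pow (z : ℂ) (n : ℕ) : slicePt i (z ^ n) = slicePt i z ^ n := by
  simp only [← sliceHom_apply, map_pow]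

theorem slicePt_ofReal (r : ℝ) : slicePt i (r : ℂ) = (r : ℍ) := by
  simp only [slicePt, Complex.ofReal_re, Complex.ofReal_im, Quaternion.coe_zero, mul_zero, add_zero]

theorem slicePt_I : slicePt i Complex.I = i := by
  simp only [slicePt, Complex.I_re, Complex.I_im, Quaternion.coe_zero, Quaternion.coe_one, mul_one,
    zero_add]

theorem slicePt_eq_smul_add_mul (z : ℂ) (q : ℍ) :
    slicePt i z * q = z.re • q + i * (z.im • q) := by
  rw [slicePt, add_mul, mul_assoc, Quaternion.coe_mul_eq_smul, Quaternion.coe_mul_eq_smul]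

theorem star_slicePt (z : ℂ) : star (slicePt i z) = slicePt i (star z) := by
  rw [slicePt, slicePt, star_add, star_mul, star_imagUnit, Quaternion.star_coe, Quaternion.star_coe,
    mul_neg, Quaternion.coe_mul_eq_smul, Complex.star_def, Complex.conj_re, Complex.conj_im,
    Quaternion.coe_neg, mul_neg, Quaternion.mul_coe_eq_smul]

theorem norm_slicePt (z : ℂ) : ‖slicePt i z‖ = ‖z‖ := by
  have h : ((‖slicePt i z‖ ^ 2 : ℝ) : ℍ) = ((‖z‖ ^ 2 : ℝ) : ℍ) := by
    rw [sq, ← normSq_eq_norm_mul_self, ← Quaternion.self_mul_star, star_slicePt, ← slicePt_mul,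
      Complex.star_def, Complex.mul_conj, slicePt_ofReal, Complex.normSq_eq_norm_sq]
  rwa [Quaternion.coe_inj, sq_eq_sq₀ (norm_nonneg _) (norm_nonneg _)] at h

/-- The identification `slicePt i` of `ℂ` with `ℂ_i` as a continuous real linear map. -/
def slicePtL : ℂ →L[ℝ] ℍ where
  toFun := slicePt i
  map_add' := slicePt_add i
  map_smul' r z := by simp only [← sliceHom_apply, map_smul, RingHom.id_apply]
  cont := continuous_slicePt i

end SlicePlane

/-- The quaternions as a complex Banach space, on which `z : ℂ` acts by left multiplication with
`slicePt i z`. The restriction of a left slice hyperholomorphic function to `𝔻_i` is holomorphic as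
a function with values in this space. -/
def SliceSpace (_i : ImagUnit) : Type := ℍ

namespace SliceSpace

variable {i : ImagUnit}

instance : NormedAddCommGroup (SliceSpace i) := inferInstanceAs (NormedAddCommGroup ℍ)

instance : CompleteSpace (SliceSpace i) := inferInstanceAs (CompleteSpace ℍ)

instance : NormedSpace ℂ (SliceSpace i) where
  smul z q := (slicePt i z * (show ℍ from q) : ℍ)
  mul_smul z w q := (congrArg (· * (show ℍ from q)) (slicePt_mul i z w)).trans (mul_assoc _ _ _)
  one_smul q := (congrArg (· * (show ℍ from q)) (slicePt_one i)).trans (one_mul _)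
  smul_zero z := mul_zero (slicePt i z)
  smul_add z q p := mul_add (slicePt i z) (show ℍ from q) (show ℍ from p)
  add_smul z w q := (congrArg (· * (show ℍ from q)) (slicePt_add i z w)).trans (add_mul _ _ _)
  zero_smul q := (congrArg (· * (show ℍ from q)) (slicePt_zero i)).trans (zero_mul _)
  norm_smul_le z q :=
    (norm_mul (slicePt i z) (show ℍ from q)).le.trans_eq (by rw [norm_slicePt]; rfl)

/-- The identity map from `SliceSpace i` to `ℍ`. -/
def toQuaternion (i : ImagUnit) : SliceSpace i ≃ₗᵢ[ℝ] ℍ where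
  toFun q := q
  invFun q := q
  map_add' _ _ := rfl
  map_smul' r q := by
    change slicePt i (r : ℂ) * (show ℍ from q) = r • (show ℍ from q)
    rw [slicePt_ofReal, Quaternion.coe_mul_eq_smul]
  norm_map' _ := rfl

theorem toQuaternion_smul (z : ℂ) (q : SliceSpace i) :
    toQuaternion i (z • q) = slicePt i z * toQuaternion i q := rfl

theorem norm_pow_smul (z : ℂ) (n : ℕ) (q : ℍ) :
    ‖z ^ n • (toQuaternion i).symm q‖ = ‖z‖ ^ n * ‖q‖ := by
  rw [norm_smul, norm_pow, LinearIsometryEquiv.norm_map]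

theorem hasDerivAt_toQuaternion {G : ℝ → SliceSpace i} {G' : SliceSpace i} {t : ℝ}
    (h : HasDerivAt G G' t) :
    HasDerivAt (fun s => toQuaternion i (G s)) (toQuaternion i G') t :=
  (toQuaternion i).toContinuousLinearEquiv.hasFDerivAt.comp_hasDerivAt t h

end SliceSpace

section Lines

variable {E : Type*} [NormedAddCommGroup E] [NormedSpace ℝ E] {f : ℂ → E} {D : ℂ →L[ℝ] E} {z : ℂ}

theorem hasDerivAt_mk_re (hf : HasFDerivAt f D z) :
    HasDerivAt (fun s : ℝ => f ⟨s, z.im⟩) (D 1) z.re := by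
  refine HasFDerivAt.comp_hasDerivAt (f := fun s : ℝ => (⟨s, z.im⟩ : ℂ)) z.re hf ?_
  simpa only [Complex.mk_eq_add_mul_I, Complex.ofRealCLM_apply, Complex.ofReal_one] using
    Complex.ofRealCLM.hasDerivAt.add_const (z.im * Complex.I)

theorem hasDerivAt_mk_im (hf : HasFDerivAt f D z) :
    HasDerivAt (fun t : ℝ => f ⟨z.re, t⟩) (D Complex.I) z.im := by
  refine HasFDerivAt.comp_hasDerivAt (f := fun t : ℝ => (⟨z.re, t⟩ : ℂ)) z.im hf ?_
  simpa only [Complex.mk_eq_add_mul_I, Complex.ofRealCLM_apply, Complex.ofReal_one, one_mul] using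
    (Complex.ofRealCLM.hasDerivAt.mul_const Complex.I).const_add (z.re : ℂ)

end Lines

section SliceHyperholomorphic

variable {f : ℍ → ℍ} {i : ImagUnit} {z : ℂ}

theorem fderiv_slice_I (hf : IsLeftSliceHyperholomorphicOn f unitBall) (hz : ‖z‖ < 1)
    {D : ℂ →L[ℝ] ℍ} (hD : HasFDerivAt (fun w => f (slicePt i w)) D z) :
    D Complex.I = i * D 1 := by
  obtain ⟨-, a, b, hab⟩ := hf
  obtain ⟨-, -, -, c, d, hax, hby, hbx, hay⟩ := hab i z.re z.im ((slicePt_mem i z).2 hz)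
  have hstem : ∀ᶠ w in 𝓝 z, f (slicePt i w) = a w.re w.im + i * b w.re w.im := by
    filter_upwards [continuous_norm.continuousAt.eventually_lt continuousAt_const hz] with w hw
    exact (hab i w.re w.im ((slicePt_mem i w).2 hw)).1
  have hline_re : ContinuousAt (fun s : ℝ => (⟨s, z.im⟩ : ℂ)) z.re :=
    (hasDerivAt_mk_re (hasFDerivAt_id (𝕜 := ℝ) z)).continuousAt
  have hline_im : ContinuousAt (fun t : ℝ => (⟨z.re, t⟩ : ℂ)) z.im :=
    (hasDerivAt_mk_im (hasFDerivAt_id (𝕜 := ℝ) z)).continuousAt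
  have hx : D 1 = c + i * d := (hasDerivAt_mk_re hD).unique <|
    (hax.add (hbx.const_mul (i : ℍ))).congr_of_eventuallyEq (hline_re.eventually hstem)
  have hy : D Complex.I = -d + i * c := (hasDerivAt_mk_im hD).unique <|
    (hay.add (hby.const_mul (i : ℍ))).congr_of_eventuallyEq (hline_im.eventually hstem)
  rw [hx, hy, mul_add, ← mul_assoc, imagUnit_mul_self, neg_one_mul, add_comm]

theorem differentiableAt_slice (hf : IsLeftSliceHyperholomorphicOn f unitBall) (hz : ‖z‖ < 1) :
    DifferentiableAt ℂ (fun w => (SliceSpace.toQuaternion i).symm (f (slicePt i w))) z := by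
  have hfz : DifferentiableAt ℝ f (slicePt i z) :=
    hf.1.differentiableAt (Metric.isOpen_ball.mem_nhds ((slicePt_mem i z).2 hz))
  have hD : HasFDerivAt (fun w => f (slicePt i w)) _ z :=
    (hfz.comp z (slicePtL i).differentiableAt).hasFDerivAt
  have hD' : HasFDerivAt (fun w => (SliceSpace.toQuaternion i).symm (f (slicePt i w))) _ z :=
    (SliceSpace.toQuaternion i).symm.toContinuousLinearEquiv.hasFDerivAt.comp z hD
  refine differentiableAt_complex_iff_differentiableAt_real.2 ⟨hD'.differentiableAt, ?_⟩
  rw [hD'.fderiv]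
  refine (SliceSpace.toQuaternion i).injective ?_
  rw [SliceSpace.toQuaternion_smul, slicePt_I]
  exact fderiv_slice_I hf hz hD

theorem exists_hasSum_slice (hf : IsLeftSliceHyperholomorphicOn f unitBall) (i : ImagUnit) :
    ∃ a : ℕ → ℍ, ∀ z : ℂ, ‖z‖ < 1 → HasSum (fun n => slicePt i z ^ n * a n) (f (slicePt i z)) := by
  let F : ℂ → SliceSpace i := fun w => (SliceSpace.toQuaternion i).symm (f (slicePt i w))
  have hF : DifferentiableOn ℂ F (Metric.ball 0 1) := fun z hz =>
    (differentiableAt_slice hf (mem_ball_zero_iff.1 hz)).differentiableWithinAt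
  refine ⟨fun n => SliceSpace.toQuaternion i ((n.factorial : ℂ)⁻¹ • iteratedDeriv n F 0),
    fun z hz => ?_⟩
  have h := (Complex.hasSum_taylorSeries_on_ball hF (mem_ball_zero_iff.2 hz)).mapL
    (SliceSpace.toQuaternion i).toContinuousLinearEquiv.toContinuousLinearMap
  refine h.congr_fun fun n => ?_
  rw [← slicePt_pow, ← SliceSpace.toQuaternion_smul, smul_comm, sub_zero]
  rfl

/-- `F` is the restriction of `f` to one slice, on which the representation formula
`f(x + jy) = ½ (F(z) + F(z̄)) - j ½ i (F(z) - F(z̄))` yields the Cauchy–Riemann equations. -/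
theorem isLeftSliceHyperholomorphicOn_of_representation (hf : DifferentiableOn ℝ f unitBall)
    {F : ℂ → SliceSpace i} (hF : ∀ z : ℂ, ‖z‖ < 1 → DifferentiableAt ℂ F z)
    (hrep : ∀ (j : ImagUnit) (z : ℂ), ‖z‖ < 1 → f (slicePt j z) =
      SliceSpace.toQuaternion i ((2⁻¹ : ℝ) • (F z + F (star z))) +
        j * SliceSpace.toQuaternion i (-(2⁻¹ : ℝ) • Complex.I • (F z - F (star z)))) :
    IsLeftSliceHyperholomorphicOn f unitBall := by
  refine ⟨hf, fun x y => SliceSpace.toQuaternion i ((2⁻¹ : ℝ) • (F ⟨x, y⟩ + F ⟨x, -y⟩)),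
    fun x y => SliceSpace.toQuaternion i (-(2⁻¹ : ℝ) • Complex.I • (F ⟨x, y⟩ - F ⟨x, -y⟩)),
    fun j x y hxy => ?_⟩
  have hz := (slicePt_mem j ⟨x, y⟩).1 hxy
  have hz' : ‖(⟨x, -y⟩ : ℂ)‖ < 1 := (_root_.norm_star (⟨x, y⟩ : ℂ)).trans_lt hz
  have hp := ((hF _ hz).hasDerivAt.hasFDerivAt).restrictScalars ℝ
  have hq := ((hF _ hz').hasDerivAt.hasFDerivAt).restrictScalars ℝ
  set p := deriv F ⟨x, y⟩
  set q := deriv F ⟨x, -y⟩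
  have hpx : HasDerivAt (fun s => F ⟨s, y⟩) p x :=
    (hasDerivAt_mk_re hp).congr_deriv (one_smul ℂ p)
  have hqx : HasDerivAt (fun s => F ⟨s, -y⟩) q x :=
    (hasDerivAt_mk_re hq).congr_deriv (one_smul ℂ q)
  have hpy : HasDerivAt (fun t => F ⟨x, t⟩) (Complex.I • p) y := hasDerivAt_mk_im hp
  have hqy : HasDerivAt (fun t => F ⟨x, -t⟩) (-(Complex.I • q)) y :=
    (HasDerivAt.scomp y (hasDerivAt_mk_im hq) (hasDerivAt_neg y)).congr_deriv
      (neg_one_smul ℝ (Complex.I • q))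
  have hII : ∀ v : SliceSpace i, Complex.I • Complex.I • v = -v := fun v => by
    rw [smul_smul, Complex.I_mul_I, neg_one_smul]
  refine ⟨hrep j ⟨x, y⟩ hz, by simp only [neg_neg, add_comm], ?_,
    SliceSpace.toQuaternion i ((2⁻¹ : ℝ) • (p + q)),
    SliceSpace.toQuaternion i (-(2⁻¹ : ℝ) • Complex.I • (p - q)),
    SliceSpace.hasDerivAt_toQuaternion ((hpx.fun_add hqx).fun_const_smul _),
    (SliceSpace.hasDerivAt_toQuaternion
      (((hpy.fun_sub hqy).fun_const_smul _).fun_const_smul _)).congr_deriv ?_,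
    SliceSpace.hasDerivAt_toQuaternion (((hpx.fun_sub hqx).fun_const_smul _).fun_const_smul _),
    (SliceSpace.hasDerivAt_toQuaternion ((hpy.fun_add hqy).fun_const_smul _)).congr_deriv ?_⟩
  · simp only [neg_neg, ← map_neg, ← smul_neg, neg_sub]
  · rw [sub_neg_eq_add, smul_add, hII, hII, ← neg_add, neg_smul_neg]
  · rw [← map_neg, neg_smul, neg_neg, smul_sub, sub_eq_add_neg]

end SliceHyperholomorphic

section PowerSeries

/-- The power series `∑ xⁿ bₙ` converges absolutely on the unit ball. -/
def ConvergesOnBall (b : ℕ → ℍ) : Prop :=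
  ∀ r : ℝ, 0 ≤ r → r < 1 → Summable fun n => r ^ n * ‖b n‖

/-- The function `∑ xⁿ bₙ` on the unit ball, extended by zero. -/
def seriesFun (b : ℕ → ℍ) : ℍ → ℍ :=
  unitBall.indicator fun x => ∑' n, x ^ n * b n

theorem seriesFun_of_notMem (b : ℕ → ℍ) {x : ℍ} (hx : x ∉ unitBall) : seriesFun b x = 0 :=
  Set.indicator_of_notMem hx _

variable {b : ℕ → ℍ} {i : ImagUnit}

theorem convergesOnBall_of_hasSum_slice {g : ℂ → ℍ}
    (h : ∀ z : ℂ, ‖z‖ < 1 → HasSum (fun n => slicePt i z ^ n * b n) (g z)) :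
    ConvergesOnBall b := fun r hr0 hr => by
  have hr' : ‖(r : ℂ)‖ = r := by rw [Complex.norm_real, Real.norm_of_nonneg hr0]
  refine (h r (hr'.trans_lt hr)).summable.norm.congr fun n => ?_
  rw [norm_mul, norm_pow, norm_slicePt, hr']

theorem ConvergesOnBall.hasSum_seriesFun (hb : ConvergesOnBall b) {x : ℍ} (hx : x ∈ unitBall) :
    HasSum (fun n => x ^ n * b n) (seriesFun b x) := by
  rw [seriesFun, Set.indicator_of_mem hx]
  refine (Summable.of_norm ?_).hasSum
  simpa only [norm_mul, norm_pow] using hb ‖x‖ (norm_nonneg x) (mem_ball_zero_iff.1 hx)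

theorem ConvergesOnBall.hasSum_seriesFun_slicePt (hb : ConvergesOnBall b) (i : ImagUnit) {z : ℂ}
    (hz : ‖z‖ < 1) : HasSum (fun n => slicePt i (z ^ n) * b n) (seriesFun b (slicePt i z)) := by
  simpa only [slicePt_pow] using hb.hasSum_seriesFun ((slicePt_mem i z).2 hz)

/-- The formal power series `∑ xⁿ bₙ` on `ℍ`. -/
def quaternionSeries (b : ℕ → ℍ) : FormalMultilinearSeries ℝ ℍ ℍ := fun n =>
  ((ContinuousLinearMap.mul ℝ ℍ).flip (b n)).compContinuousMultilinearMap
    (ContinuousMultilinearMap.mkPiAlgebraFin ℝ n ℍ)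

theorem quaternionSeries_apply (b : ℕ → ℍ) (n : ℕ) (m : Fin n → ℍ) :
    quaternionSeries b n m = (List.ofFn m).prod * b n := rfl

theorem norm_quaternionSeries_le (b : ℕ → ℍ) (n : ℕ) : ‖quaternionSeries b n‖ ≤ ‖b n‖ := by
  refine ContinuousMultilinearMap.opNorm_le_bound (norm_nonneg _) fun m => ?_
  have hm : ‖(List.ofFn m).prod‖ ≤ ∏ k, ‖m k‖ := by
    simpa only [ContinuousMultilinearMap.mkPiAlgebraFin_apply,
      ContinuousMultilinearMap.norm_mkPiAlgebraFin, one_mul] using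
      (ContinuousMultilinearMap.mkPiAlgebraFin ℝ n ℍ).le_opNorm m
  rw [quaternionSeries_apply, norm_mul, mul_comm]
  gcongr

theorem ConvergesOnBall.one_le_radius (hb : ConvergesOnBall b) :
    1 ≤ (quaternionSeries b).radius := by
  refine ENNReal.le_of_forall_nnreal_lt fun r hr => ?_
  refine (quaternionSeries b).le_radius_of_summable_norm ?_
  refine (hb r r.2 (by exact_mod_cast hr)).of_nonneg_of_le (fun n => by positivity) fun n => ?_
  rw [mul_comm]
  gcongr
  exact norm_quaternionSeries_le b n

theorem ConvergesOnBall.differentiableOn_seriesFun (hb : ConvergesOnBall b) :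
    DifferentiableOn ℝ (seriesFun b) unitBall := by
  have hball : unitBall ⊆ Metric.eball (0 : ℍ) (quaternionSeries b).radius := by
    rw [unitBall, ← Metric.eball_ofReal, ENNReal.ofReal_one]
    exact Metric.eball_subset_eball hb.one_le_radius
  have hdiff := ((quaternionSeries b).hasFPowerSeriesOnBall
    (one_pos.trans_le hb.one_le_radius)).differentiableOn.mono hball
  refine hdiff.congr fun x hx => ?_
  rw [seriesFun, Set.indicator_of_mem hx, FormalMultilinearSeries.sum]
  refine tsum_congr fun n => ?_
  rw [quaternionSeries_apply, List.ofFn_const, List.prod_replicate]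

theorem ConvergesOnBall.hasSum_pow_smul (hb : ConvergesOnBall b) {z : ℂ} (hz : ‖z‖ < 1) :
    HasSum (fun n => z ^ n • (SliceSpace.toQuaternion i).symm (b n))
      ((SliceSpace.toQuaternion i).symm (seriesFun b (slicePt i z))) := by
  refine ((hb.hasSum_seriesFun_slicePt i hz).mapL
    (SliceSpace.toQuaternion i).symm.toContinuousLinearEquiv.toContinuousLinearMap).congr_fun
    fun n => ?_
  rfl

theorem ConvergesOnBall.differentiableAt_seriesFun_slicePt (hb : ConvergesOnBall b) {z : ℂ}
    (hz : ‖z‖ < 1) :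
    DifferentiableAt ℂ (fun w => (SliceSpace.toQuaternion i).symm (seriesFun b (slicePt i w)))
      z := by
  obtain ⟨r, hzr, hr1⟩ := exists_between hz
  have h := Complex.differentiableOn_tsum_of_summable_norm
    (F := fun n (w : ℂ) => w ^ n • (SliceSpace.toQuaternion i).symm (b n))
    (U := Metric.ball 0 r) (hb r ((norm_nonneg z).trans hzr.le) hr1)
    (fun n => by fun_prop) Metric.isOpen_ball fun n w hw => by
      rw [SliceSpace.norm_pow_smul]
      gcongr
      exact (mem_ball_zero_iff.1 hw).le
  refine (h.congr fun w hw => ?_).differentiableAt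
    (Metric.isOpen_ball.mem_nhds (mem_ball_zero_iff.2 hzr))
  exact (hb.hasSum_pow_smul ((mem_ball_zero_iff.1 hw).trans hr1)).tsum_eq.symm

theorem add_mul_eq_of_imagUnit (i : ImagUnit) (j p q : ℍ) : p + j * q =
    (2⁻¹ : ℝ) • ((p + i * q) + (p - i * q)) -
      j * ((2⁻¹ : ℝ) • (i * ((p + i * q) - (p - i * q)))) := by
  have hsum : (p + i * q) + (p - i * q) = (2 : ℝ) • p := by module
  have hdiff : (p + i * q) - (p - i * q) = (2 : ℝ) • (i * q) := by module
  rw [hsum, hdiff, mul_smul_comm 2 (i : ℍ), inv_smul_smul₀ two_ne_zero,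
    inv_smul_smul₀ two_ne_zero, ← mul_assoc (i : ℍ), imagUnit_mul_self, neg_one_mul, mul_neg,
    sub_neg_eq_add]

theorem ConvergesOnBall.seriesFun_representation (hb : ConvergesOnBall b) (i j : ImagUnit) {z : ℂ}
    (hz : ‖z‖ < 1) : seriesFun b (slicePt j z) =
      (2⁻¹ : ℝ) • (seriesFun b (slicePt i z) + seriesFun b (slicePt i (star z))) -
        j * ((2⁻¹ : ℝ) • (i * (seriesFun b (slicePt i z) - seriesFun b (slicePt i (star z))))) := by
  have h := hb.hasSum_seriesFun_slicePt i hz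
  have h' := hb.hasSum_seriesFun_slicePt i (z := star z) (by rwa [_root_.norm_star])
  refine (hb.hasSum_seriesFun_slicePt j hz).unique <|
    (((h.add h').const_smul (2⁻¹ : ℝ)).sub
      ((((h.sub h').mul_left (i : ℍ)).const_smul (2⁻¹ : ℝ)).mul_left (j : ℍ))).congr_fun fun n => ?_
  rw [← star_pow, slicePt_eq_smul_add_mul, slicePt_eq_smul_add_mul, slicePt_eq_smul_add_mul,
    Complex.star_def, Complex.conj_re, Complex.conj_im, neg_smul, mul_neg, ← sub_eq_add_neg]
  exact add_mul_eq_of_imagUnit i j ((z ^ n).re • b n) ((z ^ n).im • b n)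

theorem ConvergesOnBall.isLeftSliceHyperholomorphicOn_seriesFun (hb : ConvergesOnBall b) :
    IsLeftSliceHyperholomorphicOn (seriesFun b) unitBall := by
  let i : ImagUnit := ⟨stdUnit 0, stdUnit_re 0, norm_stdUnit 0⟩
  refine isLeftSliceHyperholomorphicOn_of_representation (i := i) hb.differentiableOn_seriesFun
    (fun z hz => hb.differentiableAt_seriesFun_slicePt hz) fun j z hz => ?_
  rw [hb.seriesFun_representation i j hz, map_smul, map_add, map_smul, SliceSpace.toQuaternion_smul,
    map_sub, slicePt_I, neg_smul, mul_neg, ← sub_eq_add_neg]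
  rfl

end PowerSeries

section Radial

variable {α : ℝ}

theorem hasDerivAt_one_sub_sq_rpow {y : ℝ} (hy : y ∈ Set.Ioo (0 : ℝ) 1) :
    HasDerivAt (fun y : ℝ => (1 - y ^ 2) ^ (α + 1)) (-(2 * (α + 1) * y * (1 - y ^ 2) ^ α)) y := by
  have hne : 1 - y ^ 2 ≠ 0 := by nlinarith [hy.1, hy.2]
  have h : HasDerivAt (fun y : ℝ => 1 - y ^ 2) (-(2 * y)) y := by
    simpa using (hasDerivAt_pow 2 y).const_sub 1
  refine (h.rpow_const (Or.inl hne)).congr_deriv ?_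
  rw [add_sub_cancel_right]
  ring

theorem continuous_one_sub_sq_rpow (hα : -1 < α) :
    Continuous fun y : ℝ => (1 - y ^ 2) ^ (α + 1) :=
  Continuous.rpow_const (by fun_prop) fun _ => Or.inr (by linarith)

theorem intervalIntegrable_radial (hα : -1 < α) (n : ℕ) :
    IntervalIntegrable (fun y : ℝ => y ^ (2 * n + 1) * (1 - y ^ 2) ^ α) volume 0 1 := by
  have hα' : 0 < α + 1 := by linarith
  have hderiv : IntervalIntegrable (fun y : ℝ => 2 * (α + 1) * y * (1 - y ^ 2) ^ α) volume 0 1 := by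
    rw [intervalIntegrable_iff_integrableOn_Ioc_of_le zero_le_one]
    refine intervalIntegral.integrableOn_deriv_of_nonneg
      (g := fun y => -(1 - y ^ 2) ^ (α + 1)) (continuous_one_sub_sq_rpow hα).neg.continuousOn
      (fun y hy => (hasDerivAt_one_sub_sq_rpow hy).fun_neg.congr_deriv (neg_neg _)) fun y hy => ?_
    have hy' : 0 ≤ 1 - y ^ 2 := by nlinarith [hy.1, hy.2]
    have hy0 := hy.1
    positivity
  refine (hderiv.continuousOn_mul (g := fun y : ℝ => (2 * (α + 1))⁻¹ * y ^ (2 * n))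
    (by fun_prop)).congr fun y _ => ?_
  field_simp
  ring

theorem integral_radial_zero (hα : -1 < α) :
    2 * (α + 1) * ∫ y in (0 : ℝ)..1, y ^ (2 * 0 + 1) * (1 - y ^ 2) ^ α = 1 := by
  have h := intervalIntegral.integral_eq_sub_of_hasDerivAt_of_le zero_le_one
    (continuous_one_sub_sq_rpow hα).continuousOn
    (fun y hy => (hasDerivAt_one_sub_sq_rpow hy).congr_deriv
      (show _ = -(2 * (α + 1)) * (y ^ (2 * 0 + 1) * (1 - y ^ 2) ^ α) by ring))
    ((intervalIntegrable_radial hα 0).const_mul _)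
  have hzero : (0 : ℝ) ^ (α + 1) = 0 := Real.zero_rpow (by linarith)
  rw [intervalIntegral.integral_const_mul, one_pow, sub_self, hzero, zero_pow two_ne_zero,
    sub_zero, Real.one_rpow] at h
  linear_combination -h

theorem integral_radial_succ (hα : -1 < α) (n : ℕ) :
    ((n : ℝ) + α + 2) * ∫ y in (0 : ℝ)..1, y ^ (2 * (n + 1) + 1) * (1 - y ^ 2) ^ α =
      (n + 1) * ∫ y in (0 : ℝ)..1, y ^ (2 * n + 1) * (1 - y ^ 2) ^ α := by
  have hn := (intervalIntegrable_radial hα n).const_mul (2 * n + 2)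
  have hn' := (intervalIntegrable_radial hα (n + 1)).const_mul (2 * n + 2 * α + 4)
  have h := intervalIntegral.integral_eq_sub_of_hasDerivAt_of_le zero_le_one
    (f := fun y => y ^ (2 * n + 2) * (1 - y ^ 2) ^ (α + 1))
    ((continuous_pow _).mul (continuous_one_sub_sq_rpow hα)).continuousOn
    (fun y hy => by
      refine ((hasDerivAt_pow (2 * n + 2) y).mul (hasDerivAt_one_sub_sq_rpow hy)).congr_deriv ?_
      have hy' : 0 < 1 - y ^ 2 := by nlinarith [hy.1, hy.2]
      rw [Real.rpow_add_one hy'.ne']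
      push_cast
      ring) (hn.sub hn')
  have hzero : (0 : ℝ) ^ (α + 1) = 0 := Real.zero_rpow (by linarith)
  rw [intervalIntegral.integral_sub hn hn', intervalIntegral.integral_const_mul,
    intervalIntegral.integral_const_mul, one_pow, one_pow, sub_self, hzero, mul_zero,
    zero_pow (by lia), zero_mul, sub_self] at h
  linear_combination -h / 2

end Radial

section AreaMeasure

variable {E : Type*} [NormedAddCommGroup E] [NormedSpace ℝ E] {α : ℝ}

theorem measurePreserving_rotation (α : ℝ) (c : Circle) :
    MeasurePreserving (rotation c) (areaMeasure α) (areaMeasure α) := by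
  have hm : Measurable (rotation c) := (rotation c).continuous.measurable
  have hball : rotation c ⁻¹' Metric.ball (0 : ℂ) 1 = Metric.ball 0 1 := by
    rw [LinearIsometryEquiv.preimage_ball, map_zero]
  have hvol := (LinearIsometryEquiv.measurePreserving (rotation c)).restrict_preimage
    (s := Metric.ball (0 : ℂ) 1) measurableSet_ball
  rw [hball] at hvol
  refine ⟨hm, Measure.ext fun S hS => ?_⟩
  rw [Measure.map_apply hm hS, areaMeasure, withDensity_apply _ hS, withDensity_apply _ (hm hS),
    ← hvol.setLIntegral_comp_preimage hS (by fun_prop)]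
  simp only [LinearIsometryEquiv.norm_map]

theorem density_nonneg (hα : -1 < α) {z : ℂ} (hz : z ∈ Metric.ball (0 : ℂ) 1) :
    0 ≤ (α + 1) / Real.pi * (1 - ‖z‖ ^ 2) ^ α := by
  have hz' : 0 ≤ 1 - ‖z‖ ^ 2 := by nlinarith [norm_nonneg z, mem_ball_zero_iff.1 hz]
  have hα' : 0 < α + 1 := by linarith
  positivity

theorem integral_areaMeasure (hα : -1 < α) (f : ℂ → E) : ∫ z, f z ∂(areaMeasure α) =
    ∫ z in Metric.ball (0 : ℂ) 1, ((α + 1) / Real.pi * (1 - ‖z‖ ^ 2) ^ α) • f z := by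
  rw [areaMeasure, integral_withDensity_eq_integral_toReal_smul (by fun_prop)
    (Eventually.of_forall fun _ => ENNReal.ofReal_lt_top)]
  refine setIntegral_congr_fun measurableSet_ball fun z hz => ?_
  rw [ENNReal.toReal_ofReal (density_nonneg hα hz)]

theorem integrable_areaMeasure_iff (hα : -1 < α) (f : ℂ → E) :
    Integrable f (areaMeasure α) ↔
      IntegrableOn (fun z => ((α + 1) / Real.pi * (1 - ‖z‖ ^ 2) ^ α) • f z)
        (Metric.ball (0 : ℂ) 1) := by
  rw [areaMeasure, integrable_withDensity_iff_integrable_smul' (by fun_prop)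
    (Eventually.of_forall fun _ => ENNReal.ofReal_lt_top)]
  refine integrableOn_congr_fun (fun z hz => ?_) measurableSet_ball
  rw [ENNReal.toReal_ofReal (density_nonneg hα hz)]

theorem ae_areaMeasure_norm_lt (α : ℝ) : ∀ᵐ z ∂(areaMeasure α), ‖z‖ < 1 := by
  refine (withDensity_absolutelyContinuous _ _).ae_le ?_
  filter_upwards [ae_restrict_mem measurableSet_ball] with z hz
  exact mem_ball_zero_iff.1 hz

theorem areaMeasure_restrict_ball (α : ℝ) :
    (areaMeasure α).restrict (Metric.ball (0 : ℂ) 1) = areaMeasure α := by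
  refine Measure.restrict_eq_self_of_ae_mem ?_
  filter_upwards [ae_areaMeasure_norm_lt α] with z hz
  exact mem_ball_zero_iff.2 hz

theorem isFiniteMeasure_areaMeasure (hα : -1 < α) : IsFiniteMeasure (areaMeasure α) := by
  have h : Integrable (fun _ : ℂ => (1 : ℝ)) (areaMeasure α) := by
    rw [integrable_areaMeasure_iff hα]
    refine (integrableOn_fun_norm_addHaar (volume : Measure ℂ) (r := 1)
      (f := fun y : ℝ => ((α + 1) / Real.pi * (1 - y ^ 2) ^ α) • (1 : ℝ))).2 ?_
    have hrad := (intervalIntegrable_radial hα 0).const_mul ((α + 1) / Real.pi)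
    rw [intervalIntegrable_iff_integrableOn_Ioo_of_le zero_le_one] at hrad
    refine hrad.congr_fun (fun y _ => ?_) measurableSet_Ioo
    simp only [Complex.finrank_real_complex, smul_eq_mul]
    ring
  exact (integrable_const_iff.1 h).resolve_left one_ne_zero

theorem integral_ball_fun_norm (f : ℝ → ℝ) : ∫ z in Metric.ball (0 : ℂ) 1, f ‖z‖ =
    2 * Real.pi * ∫ y in (0 : ℝ)..1, y * f y := by
  have h := integral_fun_norm_addHaar (volume : Measure ℂ) ((Set.Iio 1).indicator f)
  have hind : ∀ z : ℂ, (Set.Iio 1).indicator f ‖z‖ =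
      (Metric.ball (0 : ℂ) 1).indicator (fun z => f ‖z‖) z := fun z => by
    simp only [Set.indicator, Set.mem_Iio, mem_ball_zero_iff]
  have hmul : ∀ y : ℝ, y ^ (2 - 1) • (Set.Iio 1).indicator f y =
      (Set.Iio 1).indicator (fun y => y * f y) y := fun y => by
    rw [Set.indicator_mul_right, pow_one, smul_eq_mul]
  have hvol : volume.real (Metric.ball (0 : ℂ) 1) = Real.pi := by
    simp [Measure.real, Complex.volume_ball]
  simp only [hind, Complex.finrank_real_complex, hmul] at h
  rw [integral_indicator measurableSet_ball, setIntegral_indicator measurableSet_Iio,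
    Set.Ioi_inter_Iio, hvol] at h
  rw [h, intervalIntegral.integral_of_le zero_le_one, integral_Ioc_eq_integral_Ioo, smul_eq_mul,
    nsmul_eq_mul, Nat.cast_two, mul_assoc]

end AreaMeasure

section Moments

variable {α : ℝ}

/-- The squared norm `∫ |z|²ⁿ dA_α` of the monomial `zⁿ`. -/
def moment (α : ℝ) (n : ℕ) : ℝ := ∫ z, ‖z‖ ^ (2 * n) ∂(areaMeasure α)

theorem moment_eq (hα : -1 < α) (n : ℕ) :
    moment α n = 2 * (α + 1) * ∫ y in (0 : ℝ)..1, y ^ (2 * n + 1) * (1 - y ^ 2) ^ α := by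
  rw [moment, integral_areaMeasure hα]
  refine (integral_ball_fun_norm
    fun y => ((α + 1) / Real.pi * (1 - y ^ 2) ^ α) • y ^ (2 * n)).trans ?_
  rw [← intervalIntegral.integral_const_mul, ← intervalIntegral.integral_const_mul]
  refine intervalIntegral.integral_congr fun y _ => ?_
  simp only [smul_eq_mul]
  field_simp
  ring

theorem moment_zero (hα : -1 < α) : moment α 0 = 1 := by
  rw [moment_eq hα, integral_radial_zero hα]

theorem moment_succ (hα : -1 < α) (n : ℕ) :
    (n + α + 2) * moment α (n + 1) = (n + 1) * moment α n := by
  rw [moment_eq hα, moment_eq hα]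
  linear_combination (2 * (α + 1)) * integral_radial_succ hα n

theorem moment_pos (hα : -1 < α) (n : ℕ) : 0 < moment α n := by
  induction n with
  | zero => exact moment_zero hα ▸ one_pos
  | succ n ih =>
    have hn : (0 : ℝ) < n + α + 2 := by linarith [n.cast_nonneg (α := ℝ)]
    exact pos_of_mul_pos_right (moment_succ hα n ▸ by positivity) hn.le

theorem succ_mul_multichoose_succ (x : ℝ) (n : ℕ) :
    (n + 1 : ℝ) * Ring.multichoose x (n + 1) = (x + n) * Ring.multichoose x n := by
  have h := Ring.factorial_nsmul_multichoose_eq_ascPochhammer x n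
  have h' := Ring.factorial_nsmul_multichoose_eq_ascPochhammer x (n + 1)
  rw [Polynomial.ascPochhammer_smeval_eq_eval] at h h'
  rw [ascPochhammer_succ_eval, ← h, Nat.factorial_succ, nsmul_eq_mul, nsmul_eq_mul] at h'
  refine mul_left_cancel₀ (Nat.cast_ne_zero.2 n.factorial_ne_zero) ?_
  push_cast at h' ⊢
  linear_combination h'

theorem multichoose_eq_inv_moment (hα : -1 < α) (n : ℕ) :
    Ring.multichoose (α + 2) n = (moment α n)⁻¹ := by
  induction n with
  | zero => rw [moment_zero hα, Ring.multichoose_zero_right, inv_one]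
  | succ n ih =>
    have hn := moment_pos hα n
    have hn' := moment_pos hα (n + 1)
    refine mul_left_cancel₀ (n.cast_add_one_ne_zero (R := ℝ)) ?_
    rw [succ_mul_multichoose_succ, ih]
    field_simp
    linear_combination moment_succ hα n

theorem hasSum_inv_moment (hα : -1 < α) {x : ℝ} (hx0 : 0 ≤ x) (hx : x < 1) :
    HasSum (fun n => (moment α n)⁻¹ * x ^ n) ((1 - x) ^ (-(α + 2))) := by
  have h := (Real.one_div_one_sub_rpow_hasFPowerSeriesOnBall_zero (α + 2)).hasSum (y := x) <| by
    rwa [← ENNReal.ofReal_one, Metric.eball_ofReal, mem_ball_zero_iff, Real.norm_of_nonneg hx0]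
  simp only [FormalMultilinearSeries.ofScalars_apply_eq, ← Ring.multichoose_eq,
    multichoose_eq_inv_moment hα, zero_add, smul_eq_mul] at h
  rwa [one_div, ← Real.rpow_neg (by linarith)] at h

end Moments

section TaylorCoefficients

variable {E : Type*} [NormedAddCommGroup E] [NormedSpace ℝ E] {α r : ℝ} {i : ImagUnit}
  {a : ℕ → ℍ} {g : ℂ → ℍ}

/-- The rotation by `π / (m - n)` changes the sign of the integrand. -/
theorem setIntegral_star_pow_mul_pow_of_ne {m n : ℕ} (hmn : m ≠ n) (α r : ℝ) :
    ∫ z in Metric.ball (0 : ℂ) r, star z ^ n * z ^ m ∂(areaMeasure α) = 0 := by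
  have hmn' : ((m : ℂ) - n) ≠ 0 := sub_ne_zero.2 (by exact_mod_cast hmn)
  let c : Circle := Circle.exp (Real.pi / (m - n))
  have hc : star (c : ℂ) ^ n * (c : ℂ) ^ m = -1 := by
    rw [Circle.coe_exp, Complex.star_def, ← Complex.exp_conj, ← Complex.exp_nat_mul,
      ← Complex.exp_nat_mul, ← Complex.exp_add, ← Complex.exp_pi_mul_I, map_mul, Complex.conj_I,
      Complex.conj_ofReal]
    congr 1
    push_cast
    field_simp
    ring
  have hneg : ∀ z : ℂ, star (rotation c z) ^ n * rotation c z ^ m = -(star z ^ n * z ^ m) :=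
    fun z => by
      rw [rotation_apply, star_mul', mul_pow, mul_pow]
      linear_combination (star z ^ n * z ^ m) * hc
  have h := (measurePreserving_rotation α c).setIntegral_preimage_emb
    (rotation c).toHomeomorph.measurableEmbedding (fun z => star z ^ n * z ^ m)
    (Metric.ball (0 : ℂ) r)
  rw [LinearIsometryEquiv.preimage_ball, map_zero] at h
  simp only [hneg, integral_neg] at h
  exact self_eq_neg.1 h.symm

theorem integrable_star_pow_mul_pow (hα : -1 < α) (n m : ℕ) :
    Integrable (fun z : ℂ => star z ^ n * z ^ m) (areaMeasure α) := by
  have := isFiniteMeasure_areaMeasure hα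
  refine Integrable.of_bound (C := 1) (Continuous.aestronglyMeasurable (by fun_prop)) ?_
  filter_upwards [ae_areaMeasure_norm_lt α] with z hz
  rw [norm_mul, norm_pow, norm_pow, _root_.norm_star]
  exact mul_le_one₀ (pow_le_one₀ (norm_nonneg z) hz.le) (by positivity)
    (pow_le_one₀ (norm_nonneg z) hz.le)

theorem star_pow_mul_pow_self (z : ℂ) (n : ℕ) :
    star z ^ n * z ^ n = ((‖z‖ ^ (2 * n) : ℝ) : ℂ) := by
  rw [← mul_pow, Complex.star_def, Complex.conj_mul', ← pow_mul, Complex.ofReal_pow]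

theorem integrable_norm_pow (hα : -1 < α) (n : ℕ) :
    Integrable (fun z : ℂ => ‖z‖ ^ (2 * n)) (areaMeasure α) :=
  (integrable_star_pow_mul_pow hα n n).norm.congr <| .of_forall fun z => by
    simp only [star_pow_mul_pow_self, Complex.norm_real, Real.norm_of_nonneg (pow_nonneg
      (norm_nonneg z) _)]

theorem star_slicePt_pow_mul (i : ImagUnit) (z : ℂ) (n m : ℕ) (c : ℍ) :
    star (slicePt i z ^ n) * (slicePt i z ^ m * c) = slicePt i (star z ^ n * z ^ m) * c := by
  rw [slicePt_mul, slicePt_pow, slicePt_pow, ← star_slicePt, star_pow, mul_assoc]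

theorem setIntegral_star_slicePt_pow_mul (hα : -1 < α) (i : ImagUnit) (r : ℝ) (n m : ℕ) (c : ℍ) :
    ∫ z in Metric.ball (0 : ℂ) r, star (slicePt i z ^ n) * (slicePt i z ^ m * c)
      ∂(areaMeasure α) =
      slicePt i (∫ z in Metric.ball (0 : ℂ) r, star z ^ n * z ^ m ∂(areaMeasure α)) * c := by
  simp only [star_slicePt_pow_mul]
  exact (((ContinuousLinearMap.mul ℝ ℍ).flip c).comp (slicePtL i)).integral_comp_comm
    (integrable_star_pow_mul_pow hα n m).integrableOn

theorem hasSum_setIntegral_star_slicePt_pow_mul (hα : -1 < α)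
    (h : ∀ z : ℂ, ‖z‖ < 1 → HasSum (fun n => slicePt i z ^ n * a n) (g z)) (hr0 : 0 ≤ r)
    (hr : r < 1) (n : ℕ) :
    HasSum (fun m => ∫ z in Metric.ball (0 : ℂ) r,
        star (slicePt i z ^ n) * (slicePt i z ^ m * a m) ∂(areaMeasure α))
      (∫ z in Metric.ball (0 : ℂ) r, star (slicePt i z ^ n) * g z ∂(areaMeasure α)) := by
  have := isFiniteMeasure_areaMeasure hα
  have hball : ∀ᵐ z ∂((areaMeasure α).restrict (Metric.ball (0 : ℂ) r)), ‖z‖ < r := by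
    filter_upwards [ae_restrict_mem measurableSet_ball] with z hz using mem_ball_zero_iff.1 hz
  refine hasSum_integral_of_dominated_convergence (fun m _ => r ^ m * ‖a m‖) (fun m => ?_)
    (fun m => ?_) (.of_forall fun _ => convergesOnBall_of_hasSum_slice h r hr0 hr)
    (integrable_const _) ?_
  · have := continuous_slicePt i
    exact Continuous.aestronglyMeasurable (by fun_prop)
  · filter_upwards [hball] with z hz
    rw [norm_mul, norm_mul, Quaternion.norm_star, norm_pow, norm_pow, norm_slicePt]
    refine (mul_le_of_le_one_left (by positivity)
      (pow_le_one₀ (norm_nonneg z) (hz.trans hr).le)).trans ?_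
    gcongr
  · filter_upwards [hball] with z hz using (h z (hz.trans hr)).mul_left _

theorem setIntegral_star_slicePt_pow_mul_of_hasSum (hα : -1 < α)
    (h : ∀ z : ℂ, ‖z‖ < 1 → HasSum (fun n => slicePt i z ^ n * a n) (g z)) (hr0 : 0 ≤ r)
    (hr : r < 1) (n : ℕ) :
    ∫ z in Metric.ball (0 : ℂ) r, star (slicePt i z ^ n) * g z ∂(areaMeasure α) =
      (∫ z in Metric.ball (0 : ℂ) r, ‖z‖ ^ (2 * n) ∂(areaMeasure α)) • a n := by
  refine (hasSum_setIntegral_star_slicePt_pow_mul hα h hr0 hr n).unique ?_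
  convert hasSum_single n fun m hm => ?_ using 1
  · rw [setIntegral_star_slicePt_pow_mul hα]
    simp only [star_pow_mul_pow_self]
    rw [integral_complex_ofReal, slicePt_ofReal, Quaternion.coe_mul_eq_smul]
  · rw [setIntegral_star_slicePt_pow_mul hα, setIntegral_star_pow_mul_pow_of_ne hm, slicePt_zero,
      zero_mul]

theorem iUnion_ball_one_sub_one_div :
    ⋃ k : ℕ, Metric.ball (0 : ℂ) (1 - 1 / ((k : ℝ) + 1)) = Metric.ball 0 1 := by
  ext z
  simp only [Set.mem_iUnion, mem_ball_zero_iff]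
  refine ⟨fun ⟨k, hk⟩ => hk.trans (sub_lt_self _ (by positivity)), fun hz => ?_⟩
  obtain ⟨k, hk⟩ := exists_nat_one_div_lt (sub_pos.2 hz)
  exact ⟨k, by linarith⟩

theorem tendsto_setIntegral_ball {f : ℂ → E} (hf : Integrable f (areaMeasure α)) :
    Tendsto (fun k : ℕ => ∫ z in Metric.ball (0 : ℂ) (1 - 1 / ((k : ℝ) + 1)), f z ∂(areaMeasure α))
      atTop (𝓝 (∫ z, f z ∂(areaMeasure α))) := by
  have h := tendsto_setIntegral_of_monotone (μ := areaMeasure α)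
    (s := fun k : ℕ => Metric.ball (0 : ℂ) (1 - 1 / ((k : ℝ) + 1)))
    (fun k => measurableSet_ball) (fun k l hkl => Metric.ball_subset_ball (by gcongr))
    hf.integrableOn
  rwa [iUnion_ball_one_sub_one_div, areaMeasure_restrict_ball] at h

theorem integral_star_slicePt_pow_mul (hα : -1 < α)
    (h : ∀ z : ℂ, ‖z‖ < 1 → HasSum (fun n => slicePt i z ^ n * a n) (g z)) (n : ℕ)
    (hg : Integrable (fun z => star (slicePt i z ^ n) * g z) (areaMeasure α)) :
    ∫ z, star (slicePt i z ^ n) * g z ∂(areaMeasure α) = moment α n • a n := by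
  refine tendsto_nhds_unique (tendsto_setIntegral_ball hg)
    (((tendsto_setIntegral_ball (integrable_norm_pow hα n)).smul_const (a n)).congr fun k => ?_)
  have hk : 1 / ((k : ℝ) + 1) ≤ 1 := (div_le_one (by positivity)).2 (by simp)
  exact (setIntegral_star_slicePt_pow_mul_of_hasSum hα h (sub_nonneg.2 hk)
    (sub_lt_self _ (by positivity)) n).symm

end TaylorCoefficients

section BergmanSpace

variable {α : ℝ} {hα : -1 < α} {i : ImagUnit}

theorem Bergman.add_apply (f g : Bergman hα i) (x : ℍ) : (f + g) x = f x + g x := rfl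

theorem Bergman.sub_apply (f g : Bergman hα i) (x : ℍ) : (f - g) x = f x - g x := rfl

theorem Bergman.neg_apply (f : Bergman hα i) (x : ℍ) : (-f) x = -f x := rfl

theorem Bergman.smul_apply (f : Bergman hα i) (a x : ℍ) : (op a • f) x = f x * a := rfl

theorem Bergman.sum_apply {ι : Type*} (s : Finset ι) (f : ι → Bergman hα i) (x : ℍ) :
    (∑ n ∈ s, f n) x = ∑ n ∈ s, f n x :=
  map_sum (⟨⟨fun g : Bergman hα i => g x, rfl⟩, fun g h => g.add_apply h x⟩ : Bergman hα i →+ ℍ) f s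

theorem Bergman.qinner_def (f g : Bergman hα i) :
    qinner f g = ∫ z, star (f (slicePt i z)) * g (slicePt i z) ∂(areaMeasure α) := rfl

theorem Bergman.ext_slice {f g : Bergman hα i}
    (h : ∀ z : ℂ, ‖z‖ < 1 → f (slicePt i z) = g (slicePt i z)) : f = g :=
  sub_eq_zero.1 <| Bergman.eq_zero_of_slice _ fun z hz => by
    rw [Bergman.sub_apply, h z hz, sub_self]

theorem Bergman.isometry_toL2 : Isometry (Bergman.toL2 hα i) :=
  AddMonoidHomClass.isometry_of_norm _ fun _ => rfl

theorem Bergman.exists_tendsto_of_cauchySeq {F : ℕ → Bergman hα i} (hF : CauchySeq F) {g : ℍ → ℍ}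
    (hg : IsLeftSliceHyperholomorphicOn g unitBall) (hg0 : ∀ x ∉ unitBall, g x = 0)
    (hlim : ∀ z : ℂ, ‖z‖ < 1 → Tendsto (fun N => F N (slicePt i z)) atTop (𝓝 (g (slicePt i z)))) :
    ∃ f : Bergman hα i, Tendsto F atTop (𝓝 f) := by
  obtain ⟨G, hG⟩ := cauchySeq_tendsto_of_complete
    (Bergman.isometry_toL2.uniformContinuous.comp_cauchySeq hF)
  have hGg : G =ᵐ[areaMeasure α] fun z => g (slicePt i z) := by
    obtain ⟨φ, hφ, hae⟩ := (tendstoInMeasure_of_tendsto_Lp hG).exists_seq_tendsto_ae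
    filter_upwards [hae, ae_all_iff.2 fun N => (F N).memLp.coeFn_toLp,
      ae_areaMeasure_norm_lt α] with z hz hFz hz1
    exact tendsto_nhds_unique (hz.congr fun N => hFz (φ N)) ((hlim z hz1).comp hφ.tendsto_atTop)
  have hmem : MemLp (fun z => g (slicePt i z)) 2 (areaMeasure α) :=
    (memLp_congr_ae hGg).1 (Lp.memLp G)
  refine ⟨⟨g, hg, hg0, hmem⟩, Bergman.isometry_toL2.isUniformInducing.isInducing.tendsto_nhds_iff.2
    (hG.trans_eq ?_)⟩
  exact congrArg 𝓝 (Lp.ext (hGg.trans hmem.coeFn_toLp.symm))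

end BergmanSpace

section Monomials

variable {α : ℝ} {hα : -1 < α} {i : ImagUnit}

attribute [local instance] realInnerProductSpace

theorem convergesOnBall_single (n : ℕ) (c : ℍ) : ConvergesOnBall (Pi.single n c) :=
  fun r _ _ => summable_of_ne_finset_zero (s := {n}) fun m hm => by
    rw [Pi.single_eq_of_ne (by simpa using hm), norm_zero, mul_zero]

theorem seriesFun_single (n : ℕ) (c : ℍ) {x : ℍ} (hx : x ∈ unitBall) :
    seriesFun (Pi.single n c) x = x ^ n * c := by
  refine ((convergesOnBall_single n c).hasSum_seriesFun hx).unique ?_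
  convert hasSum_single n fun m hm => ?_ using 1
  · rw [Pi.single_eq_same]
  · rw [Pi.single_eq_of_ne hm, mul_zero]

theorem ConvergesOnBall.aestronglyMeasurable_seriesFun {b : ℕ → ℍ} (hb : ConvergesOnBall b)
    (α : ℝ) (i : ImagUnit) :
    AEStronglyMeasurable (fun z => seriesFun b (slicePt i z)) (areaMeasure α) := by
  rw [← areaMeasure_restrict_ball]
  refine ContinuousOn.aestronglyMeasurable ?_ measurableSet_ball
  exact hb.differentiableOn_seriesFun.continuousOn.comp (continuous_slicePt i).continuousOn
    fun z hz => (slicePt_mem i z).2 (mem_ball_zero_iff.1 hz)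

theorem memLp_seriesFun_single (hα : -1 < α) (i : ImagUnit) (n : ℕ) (c : ℍ) :
    MemLp (fun z => seriesFun (Pi.single n c) (slicePt i z)) 2 (areaMeasure α) := by
  have := isFiniteMeasure_areaMeasure hα
  refine MemLp.of_bound ((convergesOnBall_single n c).aestronglyMeasurable_seriesFun α i) ‖c‖ ?_
  filter_upwards [ae_areaMeasure_norm_lt α] with z hz
  rw [seriesFun_single n c ((slicePt_mem i z).2 hz), norm_mul, norm_pow, norm_slicePt]
  exact mul_le_of_le_one_left (norm_nonneg c) (pow_le_one₀ (norm_nonneg z) hz.le)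

/-- The normalized monomials `zⁿ / ‖zⁿ‖`, an orthonormal basis of the Bergman space. -/
def monomial (hα : -1 < α) (i : ImagUnit) (n : ℕ) : Bergman hα i :=
  ⟨seriesFun (Pi.single n ((√(moment α n))⁻¹ : ℝ)),
    (convergesOnBall_single n _).isLeftSliceHyperholomorphicOn_seriesFun,
    fun _ => seriesFun_of_notMem _, memLp_seriesFun_single hα i n _⟩

theorem sqrt_moment_ne_zero (hα : -1 < α) (n : ℕ) : √(moment α n) ≠ 0 :=
  Real.sqrt_ne_zero'.2 (moment_pos hα n)

theorem monomial_apply (n : ℕ) {z : ℂ} (hz : ‖z‖ < 1) :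
    monomial hα i n (slicePt i z) = (√(moment α n))⁻¹ • slicePt i z ^ n :=
  (seriesFun_single n _ ((slicePt_mem i z).2 hz)).trans (Quaternion.mul_coe_eq_smul _ _)

theorem qinner_monomial {f : Bergman hα i} {a : ℕ → ℍ}
    (h : ∀ z : ℂ, ‖z‖ < 1 → HasSum (fun n => slicePt i z ^ n * a n) (f (slicePt i z))) (n : ℕ) :
    qinner (monomial hα i n) f = √(moment α n) • a n := by
  have hsqrt := sqrt_moment_ne_zero hα n
  have hae : (fun z => star (slicePt i z ^ n) * f (slicePt i z)) =ᵐ[areaMeasure α]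
      √(moment α n) • fun z => star (monomial hα i n (slicePt i z)) * f (slicePt i z) := by
    filter_upwards [ae_areaMeasure_norm_lt α] with z hz
    rw [Pi.smul_apply, monomial_apply n hz, Quaternion.star_smul, smul_mul_assoc,
      smul_inv_smul₀ hsqrt]
  have hint := (((monomial hα i n).integrable_star_mul f).smul _).congr hae.symm
  have hcoeff := integral_star_slicePt_pow_mul hα h n hint
  rw [integral_congr_ae hae] at hcoeff
  simp only [Pi.smul_apply, integral_smul] at hcoeff
  rw [← Bergman.qinner_def] at hcoeff
  refine smul_right_injective ℍ hsqrt (hcoeff.trans ?_)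
  dsimp only
  rw [smul_smul, Real.mul_self_sqrt (moment_pos hα n).le]

theorem hasSum_monomial_apply (f : Bergman hα i) {z : ℂ} (hz : ‖z‖ < 1) :
    HasSum (fun n => monomial hα i n (slicePt i z) * qinner (monomial hα i n) f)
      (f (slicePt i z)) := by
  obtain ⟨a, ha⟩ := exists_hasSum_slice f.slice i
  convert ha z hz using 2 with n
  rw [monomial_apply n hz, qinner_monomial ha, smul_mul_smul_comm,
    inv_mul_cancel₀ (sqrt_moment_ne_zero hα n), one_smul]

theorem eq_of_qinner_monomial {f g : Bergman hα i}
    (h : ∀ n, qinner (monomial hα i n) f = qinner (monomial hα i n) g) : f = g := by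
  refine Bergman.ext_slice fun z hz => (hasSum_monomial_apply f hz).unique ?_
  simpa only [h] using hasSum_monomial_apply g hz

theorem qorthonormal_monomial : QOrthonormal (monomial hα i) := by
  have h : ∀ m n, qinner (monomial hα i m) (monomial hα i n) =
      √(moment α m) • (Pi.single n (((√(moment α n))⁻¹ : ℝ) : ℍ) : ℕ → ℍ) m := fun m n =>
    qinner_monomial
      (fun _ hz => (convergesOnBall_single n _).hasSum_seriesFun ((slicePt_mem i _).2 hz)) m
  refine ⟨fun n => ?_, fun m n hmn => ?_⟩
  · rw [h, Pi.single_eq_same, ← Quaternion.coe_smul, smul_eq_mul,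
      mul_inv_cancel₀ (sqrt_moment_ne_zero hα n), Quaternion.coe_one]
  · rw [h, Pi.single_eq_of_ne hmn, smul_zero]

theorem convergesOnBall_smul_of_summable_norm_sq (hα : -1 < α) {a : ℕ → ℍ}
    (ha : Summable fun n => ‖a n‖ ^ 2) : ConvergesOnBall fun n => (√(moment α n))⁻¹ • a n := by
  intro r hr0 hr1
  have hr := (hasSum_inv_moment hα (sq_nonneg r) (by nlinarith)).summable
  refine (hr.add ha).of_nonneg_of_le (fun n => by positivity) fun n => ?_
  have hsq : (moment α n)⁻¹ * (r ^ 2) ^ n = (r ^ n * (√(moment α n))⁻¹) ^ 2 := by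
    rw [mul_pow, inv_pow, Real.sq_sqrt (moment_pos hα n).le, ← pow_mul, ← pow_mul, mul_comm 2 n,
      mul_comm]
  rw [hsq, norm_smul, norm_inv, Real.norm_of_nonneg (Real.sqrt_nonneg _), ← mul_assoc]
  nlinarith [two_mul_le_add_sq (r ^ n * (√(moment α n))⁻¹) ‖a n‖,
    sq_nonneg (r ^ n * (√(moment α n))⁻¹), sq_nonneg ‖a n‖]

theorem summable_smul_monomial {a : ℕ → ℍ} (ha : Summable fun n => ‖a n‖ ^ 2) :
    Summable fun n => op (a n) • monomial hα i n := by
  have hb := convergesOnBall_smul_of_summable_norm_sq hα ha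
  have hF := (qorthonormal_monomial (hα := hα) (i := i)).cauchySeq_sum_smul ha
  have hlim : ∀ z : ℂ, ‖z‖ < 1 → Tendsto
      (fun N => (∑ n ∈ Finset.range N, op (a n) • monomial hα i n) (slicePt i z)) atTop
      (𝓝 (seriesFun (fun n => (√(moment α n))⁻¹ • a n) (slicePt i z))) := fun z hz => by
    refine (hb.hasSum_seriesFun ((slicePt_mem i z).2 hz)).tendsto_sum_nat.congr fun N => ?_
    simp only [Bergman.sum_apply, Bergman.smul_apply, monomial_apply _ hz, smul_mul_assoc,
      mul_smul_comm]
  obtain ⟨f, hf⟩ := Bergman.exists_tendsto_of_cauchySeq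
    (hF.comp_tendsto tendsto_finset_range) hb.isLeftSliceHyperholomorphicOn_seriesFun
    (fun _ => seriesFun_of_notMem _) hlim
  exact ⟨f, tendsto_nhds_of_cauchySeq_of_subseq hF tendsto_finset_range hf⟩

theorem isQBasis_monomial (hα : -1 < α) (i : ImagUnit) : IsQBasis (monomial hα i) :=
  qorthonormal_monomial.isQBasis (fun _ _ => eq_of_qinner_monomial)
    fun _ => summable_smul_monomial

theorem completeSpace_bergman (hα : -1 < α) (i : ImagUnit) : CompleteSpace (Bergman hα i) :=
  (isQBasis_monomial hα i).completeSpace fun _ => summable_smul_monomial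

end Monomials

section Kernel

variable {α : ℝ} {hα : -1 < α} {i : ImagUnit}

attribute [local instance] realInnerProductSpace

theorem hasSum_norm_monomial_apply_sq {z : ℂ} (hz : ‖z‖ < 1) :
    HasSum (fun n => ‖monomial hα i n (slicePt i z)‖ ^ 2) ((1 - ‖z‖ ^ 2) ^ (-(α + 2))) := by
  convert hasSum_inv_moment hα (sq_nonneg ‖z‖) (by nlinarith [norm_nonneg z]) using 2 with n
  rw [monomial_apply n hz, norm_smul, norm_pow, norm_slicePt, norm_inv,
    Real.norm_of_nonneg (Real.sqrt_nonneg _), mul_pow, inv_pow, Real.sq_sqrt (moment_pos hα n).le,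
    pow_right_comm]

/-- The kernel is `K_w = ∑ₙ eₙ conj(eₙ(w))` for the normalized monomials `eₙ`. -/
theorem qinner_bergmanKernel {z : ℂ} (hz : ‖z‖ < 1) (f : Bergman hα i) :
    qinner (bergmanKernel hα i (slicePt i z)) f = f (slicePt i z) := by
  have hex : ∃ K : Bergman hα i, ∀ f : Bergman hα i, f (slicePt i z) = qinner K f := by
    have hsum : Summable fun n => op (star (monomial hα i n (slicePt i z))) • monomial hα i n :=
      summable_smul_monomial (by
        simpa only [Quaternion.norm_star] using (hasSum_norm_monomial_apply_sq hz).summable)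
    refine ⟨∑' n, op (star (monomial hα i n (slicePt i z))) • monomial hα i n, fun f => ?_⟩
    have hK := (hsum.hasSum.mapL (qinnerL f)).star
    simp only [qinnerL_apply, qinner_smul_right, star_mul, star_star, star_qinner] at hK
    exact (hasSum_monomial_apply f hz).unique hK
  rw [bergmanKernel, dif_pos hex]
  exact (hex.choose_spec f).symm

theorem qinner_bergmanKernel_right {z : ℂ} (hz : ‖z‖ < 1) (f : Bergman hα i) :
    qinner f (bergmanKernel hα i (slicePt i z)) = star (f (slicePt i z)) := by
  rw [← star_qinner, qinner_bergmanKernel hz]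

theorem re_bergmanKernel_self {z : ℂ} (hz : ‖z‖ < 1) :
    (bergmanKernel hα i (slicePt i z) (slicePt i z)).re = (1 - ‖z‖ ^ 2) ^ (-(α + 2)) := by
  rw [← qinner_bergmanKernel hz, re_qinner_self]
  refine ((isQBasis_monomial hα i).hasSum_norm_qinner_sq _).unique ?_
  simpa only [qinner_bergmanKernel_right hz, Quaternion.norm_star] using
    hasSum_norm_monomial_apply_sq hz

end Kernel

section BergmanJ

variable {α : ℝ} {hα : -1 < α} {i : ImagUnit}

theorem bergmanJ_apply (f : Bergman hα i) {z : ℂ} (hz : ‖z‖ < 1) :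
    bergmanJ hα i f (slicePt i z) = i * f (slicePt i z) :=
  multFun_slice i f.slice hz

theorem bergmanJ_bergmanJ (f : Bergman hα i) : bergmanJ hα i (bergmanJ hα i f) = -f :=
  Bergman.ext_slice fun z hz => by
    rw [bergmanJ_apply _ hz, bergmanJ_apply _ hz, ← mul_assoc, imagUnit_mul_self, neg_one_mul,
      Bergman.neg_apply]

theorem isAntiSelfAdjoint_bergmanJ (hα : -1 < α) (i : ImagUnit) :
    IsAntiSelfAdjoint (bergmanJ hα i) := fun f g => by
  rw [Bergman.qinner_def, Bergman.qinner_def]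
  refine integral_congr_ae ?_
  filter_upwards [ae_areaMeasure_norm_lt α] with z hz
  rw [Bergman.neg_apply, bergmanJ_apply f hz, bergmanJ_apply g hz, star_neg, star_mul,
    star_imagUnit, mul_neg, neg_neg, mul_assoc]

theorem monomial_mem_plusSpace (n : ℕ) : monomial hα i n ∈ plusSpace (bergmanJ hα i) i :=
  Bergman.ext_slice fun z hz => by
    have hcomm : (i : ℍ) * slicePt i z ^ n = slicePt i z ^ n * i := by
      rw [← slicePt_pow, ← slicePt_I, slicePt_comm]
    rw [bergmanJ_apply _ hz, Bergman.smul_apply, monomial_apply n hz, mul_smul_comm,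
      smul_mul_assoc, hcomm]

theorem bergmanKernel_mem_plusSpace {z : ℂ} (hz : ‖z‖ < 1) :
    bergmanKernel hα i (slicePt i z) ∈ plusSpace (bergmanJ hα i) i := by
  refine eq_of_qinner_monomial fun n => ?_
  have hcomm : (i : ℍ) * star (slicePt i z) ^ n = star (slicePt i z) ^ n * i := by
    rw [star_slicePt, ← slicePt_pow, ← slicePt_I, slicePt_comm]
  rw [← isAntiSelfAdjoint_bergmanJ hα i, monomial_mem_plusSpace n, qinner_neg_left,
    qinner_smul_left, star_imagUnit, neg_mul, neg_neg, qinner_smul_right,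
    qinner_bergmanKernel_right hz, monomial_apply n hz, Quaternion.star_smul, star_pow,
    mul_smul_comm, smul_mul_assoc, hcomm]

theorem isPlusBasis_monomial (hα : -1 < α) (i : ImagUnit) :
    IsPlusBasis (bergmanJ hα i) i (Set.range (monomial hα i)) := by
  have hb := isQBasis_monomial hα i
  refine ⟨Set.range_subset_iff.2 monomial_mem_plusSpace, Set.forall_mem_range.2 hb.self,
    ?_, fun x _ => ?_⟩
  · rintro _ ⟨m, rfl⟩ _ ⟨n, rfl⟩ h
    exact hb.orthogonal m n (ne_of_apply_ne _ h)
  · exact (hb.injective.hasSum_range_iff (f := fun e => op (qinner e x) • e)).2 (hb.hasSum x)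

end BergmanJ

section Berezin

variable {α : ℝ} {hα : -1 < α} {i : ImagUnit}

attribute [local instance] realInnerProductSpace

/-- The function `z ↦ ⟨K_z, T K_z⟩`, which is `T̃` without the normalization of the kernel. -/
def kernelForm (T : Bergman hα i →L[ℍᵐᵒᵖ] Bergman hα i) (z : ℂ) : ℍ :=
  qinner (bergmanKernel hα i (slicePt i z)) (T (bergmanKernel hα i (slicePt i z)))

theorem berezin_eq (T : Bergman hα i →L[ℍᵐᵒᵖ] Bergman hα i) {z : ℂ} (hz : ‖z‖ < 1) :
    berezin T z = ((1 - ‖z‖ ^ 2) ^ (α + 2)) • kernelForm T z := by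
  have hpos : 0 < 1 - ‖z‖ ^ 2 := by nlinarith [norm_nonneg z]
  rw [berezin, normalizedKernel, map_smul, qinner_smul_left, qinner_smul_right,
    Quaternion.star_coe, Quaternion.mul_coe_eq_smul, Quaternion.coe_mul_eq_smul, smul_smul,
    re_bergmanKernel_self hz, ← mul_inv, Real.mul_self_sqrt (by positivity),
    Real.rpow_neg hpos.le, inv_inv, kernelForm]

theorem density_smul_berezin (T : Bergman hα i →L[ℍᵐᵒᵖ] Bergman hα i) {z : ℂ} (hz : ‖z‖ < 1) :
    (α + 1) • (1 / (Real.pi * (1 - ‖z‖ ^ 2) ^ 2)) • berezin T z =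
      ((α + 1) / Real.pi * (1 - ‖z‖ ^ 2) ^ α) • kernelForm T z := by
  have hpos : 0 < 1 - ‖z‖ ^ 2 := by nlinarith [norm_nonneg z]
  rw [berezin_eq T hz, smul_smul, smul_smul, Real.rpow_add hpos, Real.rpow_two]
  congr 1
  field_simp

theorem integrable_berezin_iff (T : Bergman hα i →L[ℍᵐᵒᵖ] Bergman hα i) :
    Integrable (berezin T) invMeasure ↔ Integrable (kernelForm T) (areaMeasure α) := by
  have hα1 : α + 1 ≠ 0 := by linarith
  rw [invMeasure, integrable_withDensity_iff_integrable_smul' (by fun_prop)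
    (Eventually.of_forall fun _ => ENNReal.ofReal_lt_top), integrable_areaMeasure_iff hα,
    ← integrable_smul_iff hα1]
  refine integrableOn_congr_fun (fun z hz => ?_) measurableSet_ball
  rw [← density_smul_berezin T (mem_ball_zero_iff.1 hz), Pi.smul_apply,
    ENNReal.toReal_ofReal (by positivity)]

theorem integral_berezin (T : Bergman hα i →L[ℍᵐᵒᵖ] Bergman hα i) :
    (α + 1) • ∫ z, berezin T z ∂invMeasure = ∫ z, kernelForm T z ∂(areaMeasure α) := by
  rw [invMeasure, integral_withDensity_eq_integral_toReal_smul (by fun_prop)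
    (Eventually.of_forall fun _ => ENNReal.ofReal_lt_top), integral_areaMeasure hα,
    ← integral_smul]
  refine setIntegral_congr_fun measurableSet_ball fun z hz => ?_
  rw [← density_smul_berezin T (mem_ball_zero_iff.1 hz), ENNReal.toReal_ofReal (by positivity)]

end Berezin

section Trace

theorem integrable_and_hasSum_integral {X E κ : Type*} [MeasurableSpace X] {μ : Measure X}
    [NormedAddCommGroup E] [NormedSpace ℝ E] [CompleteSpace E] [Countable κ] {F : κ → X → E}
    {f : X → E} (hF : ∀ n, Integrable (F n) μ) (hs : Summable fun n => ∫ x, ‖F n x‖ ∂μ)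
    (hf : ∀ᵐ x ∂μ, HasSum (fun n => F n x) (f x)) :
    Integrable f μ ∧ HasSum (fun n => ∫ x, F n x ∂μ) (∫ x, f x ∂μ) := by
  have hmeas : AEStronglyMeasurable f μ :=
    aestronglyMeasurable_of_tendsto_ae atTop
      (fun s => (integrable_finsetSum s fun n _ => hF n).aestronglyMeasurable) hf
  have hfin : ∫⁻ x, ‖f x‖ₑ ∂μ < ⊤ := calc
    ∫⁻ x, ‖f x‖ₑ ∂μ ≤ ∫⁻ x, ∑' n, ‖F n x‖ₑ ∂μ := by
      refine lintegral_mono_ae ?_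
      filter_upwards [hf] with x hx
      exact hx.tsum_eq ▸ enorm_tsum_le_tsum_enorm
    _ = ∑' n, ENNReal.ofReal (∫ x, ‖F n x‖ ∂μ) := by
      rw [lintegral_tsum fun n => (hF n).aestronglyMeasurable.enorm]
      exact tsum_congr fun n => (ofReal_integral_norm_eq_lintegral_enorm (hF n)).symm
    _ < ⊤ := hs.tsum_ofReal_ne_top.lt_top
  refine ⟨⟨hmeas, hfin⟩, ?_⟩
  rw [← integral_congr_ae (hf.mono fun x hx => hx.tsum_eq)]
  exact hasSum_integral_of_summable_integral_norm hF hs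

variable {α : ℝ} {hα : -1 < α} {i : ImagUnit} {κ : Type*}
  {J T : Bergman hα i →L[ℍᵐᵒᵖ] Bergman hα i} {u v : κ → Bergman hα i}

attribute [local instance] realInnerProductSpace

theorem Bergman.integrable_mul_star (f g : Bergman hα i) :
    Integrable (fun z => f (slicePt i z) * star (g (slicePt i z))) (areaMeasure α) :=
  MemLp.integrable_mul (p := 2) (q := 2) f.memLp g.memLp.star

theorem Bergman.integral_norm_mul_star_le (f g : Bergman hα i) :
    ∫ z, ‖f (slicePt i z) * star (g (slicePt i z))‖ ∂(areaMeasure α) ≤ ‖f‖ * ‖g‖ := by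
  have h := integral_mul_norm_le_Lp_mul_Lq (μ := areaMeasure α) (p := 2) (q := 2)
    Real.HolderConjugate.two_two (f := fun z => f (slicePt i z)) (g := fun z => g (slicePt i z))
    (by simpa using f.memLp) (by simpa using g.memLp)
  simp only [Real.rpow_two, Bergman.integral_normSq, ← Real.sqrt_eq_rpow,
    Real.sqrt_sq (norm_nonneg _)] at h
  simpa only [norm_mul, Quaternion.norm_star] using h

theorem re_mul_comm (p q : ℍ) : (p * q).re = (q * p).re := by
  rw [Quaternion.re_mul, Quaternion.re_mul]
  ring

theorem Bergman.re_integral_mul_star (f g : Bergman hα i) :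
    (∫ z, f (slicePt i z) * star (g (slicePt i z)) ∂(areaMeasure α)).re = (qinner g f).re := by
  simp only [Bergman.qinner_def, ← reL_apply, ← reL.integral_comp_comm (f.integrable_mul_star g),
    ← reL.integral_comp_comm (g.integrable_star_mul f)]
  simp only [reL_apply, re_mul_comm]

theorem IsNuclearRep.hasSum_kernelForm (h : IsNuclearRep u v T) {z : ℂ} (hz : ‖z‖ < 1) :
    HasSum (fun n => u n (slicePt i z) * star (v n (slicePt i z))) (kernelForm T z) := by
  have hK := h.hasSum_qinner (bergmanKernel hα i (slicePt i z)) (bergmanKernel hα i (slicePt i z))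
  simp only [qinner_bergmanKernel hz (u _), qinner_bergmanKernel_right hz] at hK
  exact hK

theorem IsNuclearRep.integrable_and_hasSum_integral_kernelForm [Countable κ]
    (h : IsNuclearRep u v T) : Integrable (kernelForm T) (areaMeasure α) ∧
      HasSum (fun n => ∫ z, u n (slicePt i z) * star (v n (slicePt i z)) ∂(areaMeasure α))
        (∫ z, kernelForm T z ∂(areaMeasure α)) := by
  refine integrable_and_hasSum_integral (fun n => (u n).integrable_mul_star (v n)) ?_ ?_
  · exact h.summable.of_nonneg_of_le (fun n => integral_nonneg fun _ => norm_nonneg _)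
      fun n => (u n).integral_norm_mul_star_le (v n)
  · filter_upwards [ae_areaMeasure_norm_lt α] with z hz using h.hasSum_kernelForm hz

theorem IsNuclearRep.integrable_kernelForm [Countable κ] (h : IsNuclearRep u v T) :
    Integrable (kernelForm T) (areaMeasure α) :=
  h.integrable_and_hasSum_integral_kernelForm.1

theorem IsNuclearRep.tsum_re_qinner_eq [Countable κ] (h : IsNuclearRep u v T) :
    ∑' n, (qinner (v n) (u n)).re = (∫ z, kernelForm T z ∂(areaMeasure α)).re := by
  simpa only [reL_apply, Bergman.re_integral_mul_star] using
    (h.integrable_and_hasSum_integral_kernelForm.2.mapL reL).tsum_eq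

theorem MemTraceClass.exists_isNuclearRep (h : MemTraceClass J T) :
    ∃ u v : ℕ → Bergman hα i, IsNuclearRep u v T :=
  let ⟨_, _, _, hs, hsum⟩ := h
  hs.exists_isNuclearRep hsum

theorem MemTraceClass.integrable_berezin (h : MemTraceClass J T) :
    Integrable (berezin T) invMeasure :=
  let ⟨_, _, huv⟩ := h.exists_isNuclearRep
  (integrable_berezin_iff T).2 huv.integrable_kernelForm

theorem kernelForm_commute (h : CommutesWith (bergmanJ hα i) T) {z : ℂ} (hz : ‖z‖ < 1) :
    (i : ℍ) * kernelForm T z = kernelForm T z * i :=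
  qinner_commute_of_mem_plusSpace (isAntiSelfAdjoint_bergmanJ hα i)
    (bergmanKernel_mem_plusSpace hz) (h.apply_mem_plusSpace (bergmanKernel_mem_plusSpace hz))

theorem kernelForm_comp_bergmanJ (T : Bergman hα i →L[ℍᵐᵒᵖ] Bergman hα i) {z : ℂ} (hz : ‖z‖ < 1) :
    kernelForm (T.comp (bergmanJ hα i)) z = kernelForm T z * i := by
  rw [kernelForm, ContinuousLinearMap.comp_apply, bergmanKernel_mem_plusSpace hz, map_smul,
    qinner_smul_right, kernelForm]

theorem MemTraceClass.hasTrace_bergmanJ (h : MemTraceClass (bergmanJ hα i) T) :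
    HasTrace (bergmanJ hα i) i T (∫ z, kernelForm T z ∂(areaMeasure α)) := by
  obtain ⟨u, v, huv⟩ := h.exists_isNuclearRep
  have hJ := isAntiSelfAdjoint_bergmanJ hα i
  have hright : (∫ z, kernelForm T z ∂(areaMeasure α)) * i =
      ∫ z, kernelForm T z * (i : ℍ) ∂(areaMeasure α) :=
    (((ContinuousLinearMap.mul ℝ ℍ).flip i).integral_comp_comm huv.integrable_kernelForm).symm
  refine huv.hasTrace bergmanJ_bergmanJ hJ h.2.1 ⟨_, isPlusBasis_monomial hα i⟩ ?_
    huv.tsum_re_qinner_eq ?_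
  · rw [hright]
    refine ((ContinuousLinearMap.mul ℝ ℍ i).integral_comp_comm
      huv.integrable_kernelForm).symm.trans (integral_congr_ae ?_)
    filter_upwards [ae_areaMeasure_norm_lt α] with z hz using kernelForm_commute h.2.1 hz
  · refine (huv.comp (A := -bergmanJ hα i) hJ).tsum_re_qinner_eq.trans ?_
    rw [hright]
    refine congrArg _ (integral_congr_ae ?_)
    filter_upwards [ae_areaMeasure_norm_lt α] with z hz using kernelForm_comp_bergmanJ T hz

theorem IsPositive.two_mul_re_kernelForm_le (hT : IsPositive T) {ι : Type*}
    (e : ι → Bergman hα i) (s : Finset ι) (z : ℂ) :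
    2 * (kernelForm (T.comp (spanProj e s)) z).re ≤
      (kernelForm T z).re + (kernelForm ((spanProj e s).comp (T.comp (spanProj e s))) z).re := by
  have h := hT.two_mul_re_qinner_le (bergmanKernel hα i (slicePt i z))
    (spanProj e s (bergmanKernel hα i (slicePt i z)))
  rwa [qinner_spanProj] at h

/-- With `P` the projection onto the span of the `eₙ`, both `T P` and `P T P` have the real trace
on the left-hand side. -/
theorem IsPositive.sum_re_qinner_le (hT : IsPositive T)
    (hint : Integrable (kernelForm T) (areaMeasure α)) {ι : Type*} {e : ι → Bergman hα i}
    (he : QOrthonormal e) (s : Finset ι) :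
    ∑ n ∈ s, (qinner (e n) (T (e n))).re ≤ (∫ z, kernelForm T z ∂(areaMeasure α)).re := by
  have hTP := (isNuclearRep_spanProj e s).comp_left T
  have hPTP := hTP.comp_left (spanProj e s)
  have hTP_re : (∫ z, kernelForm (T.comp (spanProj e s)) z ∂(areaMeasure α)).re =
      ∑ n ∈ s, (qinner (e n) (T (e n))).re := by
    rw [← hTP.tsum_re_qinner_eq, tsum_fintype,
      Finset.sum_coe_sort s fun n => (qinner (e n) (T (e n))).re]
  have hPTP_re : (∫ z, kernelForm ((spanProj e s).comp (T.comp (spanProj e s))) z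
      ∂(areaMeasure α)).re = ∑ n ∈ s, (qinner (e n) (T (e n))).re := by
    rw [← hPTP.tsum_re_qinner_eq, tsum_fintype,
      ← Finset.sum_coe_sort s fun n => (qinner (e n) (T (e n))).re]
    refine Finset.sum_congr rfl fun n _ => ?_
    rw [← qinner_spanProj, he.spanProj_apply_self n.2]
  have hle := integral_mono ((reL.integrable_comp hTP.integrable_kernelForm).const_mul 2)
    ((reL.integrable_comp hint).add (reL.integrable_comp hPTP.integrable_kernelForm))
    fun z => by
      simpa only [Pi.add_apply, reL_apply] using hT.two_mul_re_kernelForm_le e s z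
  rw [integral_const_mul, integral_add' (reL.integrable_comp hint)
    (reL.integrable_comp hPTP.integrable_kernelForm), reL.integral_comp_comm hint,
    reL.integral_comp_comm hTP.integrable_kernelForm,
    reL.integral_comp_comm hPTP.integrable_kernelForm, reL_apply, reL_apply, reL_apply, hTP_re,
    hPTP_re] at hle
  linarith

theorem IsPositive.memTraceClass_of_integrable_berezin (hT : IsPositive T)
    (hJ : CommutesWith J T) (hint : Integrable (berezin T) invMeasure) : MemTraceClass J T :=
  have := completeSpace_bergman hα i
  hT.memTraceClass_of_summable hJ (isQBasis_monomial hα i) <|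
    summable_of_sum_le (fun _ => hT.re_nonneg _) <|
      hT.sum_re_qinner_le ((integrable_berezin_iff T).1 hint)
        (isQBasis_monomial hα i).toQOrthonormal

end Trace

end SliceBergman

end

open SliceBergman in
theorem mainTheorem4_general {α : ℝ} (hα : -1 < α) (i : ImagUnit) :
    (∀ J T : Bergman hα i →L[ℍᵐᵒᵖ] Bergman hα i, CommutesWith J T → IsPositive T →
      (MemTraceClass J T ↔ Integrable (berezin T) invMeasure)) ∧
    (∀ T : Bergman hα i →L[ℍᵐᵒᵖ] Bergman hα i, MemTraceClass (bergmanJ hα i) T →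
      Integrable (berezin T) invMeasure ∧
      HasTrace (bergmanJ hα i) i T ((α + 1) • ∫ z, berezin T z ∂invMeasure)) := by
  refine ⟨fun J T hJ hT => ⟨MemTraceClass.integrable_berezin,
    hT.memTraceClass_of_integrable_berezin hJ⟩, fun T hT => ⟨hT.integrable_berezin, ?_⟩⟩
  rw [integral_berezin]
  exact hT.hasTrace_bergmanJ

open SliceBergman in
theorem mainTheorem4 {α : ℝ} (hα : -1 < α) (i : ImagUnit) :
    (∀ J : Bergman hα i →L[ℍᵐᵒᵖ] Bergman hα i, IsUnitary J → IsAntiSelfAdjoint J →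
      ∀ T : Bergman hα i →L[ℍᵐᵒᵖ] Bergman hα i, CommutesWith J T → IsPositive T →
        (MemTraceClass J T ↔ Integrable (berezin T) invMeasure)) ∧
    (∀ T : Bergman hα i →L[ℍᵐᵒᵖ] Bergman hα i, MemTraceClass (bergmanJ hα i) T →
      Integrable (berezin T) invMeasure ∧
      HasTrace (bergmanJ hα i) i T ((α + 1) • ∫ z, berezin T z ∂invMeasure)) :=
  ⟨fun J _ _ => (mainTheorem4_general hα i).1 J, (mainTheorem4_general hα i).2⟩
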